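/- Let $\alpha>1$, $1/\alpha+1/\beta=1$, $\Phi(u)=|u|^{\alpha-1}\operatorname{sgn}u$, let $r,p$ be positive continuous functions on $[a,\infty)$, and let $\tau\in C^1([a,\infty))$ satisfy $\tau'>0$ and $\tau(t)\le t$. Consider the equation $$(r(t)\Phi(y'))'=p(t)\Phi(y(\tau(t))).\qquad (*)$$ Let $\mathcal{IS}$ be the set of functions $y$ that are, for large $t$, positive classical solutions of $(*)$ (that is, $y$ and $y^{[1]}:=r\Phi(y')$ are $C^1$ and $(*)$ holds) with $y'(t)>0$. Let $\mathcal{IS}_{\infty,\infty}$ be the set of $y\in\mathcal{IS}$ with $y\to\infty$ and $y^{[1]}\to\infty$, and $\mathcal{IS}_{B,\infty}$ the set of $y\in\mathcal{IS}$ such that $y$ tends to a nonzero real number and $y^{[1]}\to\infty$, as $t\to\infty$. A function $f$ that is measurable and positive on some half-line $[A,\infty)$ is regularly varying of index $\vartheta$, $f\in\mathcal{RV}(\vartheta)$, if $f(\lambda t)/f(t)\to\lambda^\vartheta$ as $t\to\infty$ for every $\lambda>0$; then $L_f(t):=f(t)/t^\vartheta$. Let $\mathcal{SV}=\mathcal{RV}(0)$,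 and let $\mathcal{NSV}$ (normalized slowly varying) be the set of functions with $f(t)=C\exp\{\int_{t_0}^t\psi(s)/s\,ds\}$ for $t\ge t_0$, for some $t_0>0$, $C>0$ and measurable $\psi$ with $\psi(s)\to0$ as $s\to\infty$. Assume $\int_a^\infty r^{1-\beta}(s)\,ds<\infty$ and put $R_C(t)=\int_t^\infty r^{1-\beta}(s)\,ds$, $Q=1/R_C$, $Q^{-1}:[Q(a),\infty)\to[a,\infty)$ the inverse of $Q$, $$\tau_C=Q\circ\tau\circ Q^{-1},\qquad p_C=(R_C^2\,p\,r^{\beta-1})\circ Q^{-1},\qquad q_C=(R_C\,p\,r^{\beta-2})^{\beta-1}.$$ Suppose that $\tau(t)\ge a$ for all large $t$ (so that $\tau_C$ is defined near infinity) and that $$p_C\in\mathcal{RV}(\alpha-2),\quad \lim_{t\to\infty}L_{p_C}(t)=0,\quad \limsup_{t\to\infty}\frac{t}{\tau_C(t)}<\infty,\quad \tau_C'\in\mathcal{SV},\quad \limsup_{t\to\infty}\tau_C'(t)<\infty .$$ **Theorem.** For every $y\in\mathcal{IS}$ one has $y\circ Q^{-1}\in\mathcal{NSV}$, and the following hold.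 (i) If $\int_a^\infty q_C(s)\,ds=\infty$, then there is a function $\varepsilon$ with $\varepsilon(t)\to0$ as $t\to\infty$ such that, for all large $t$, $$y(t)=\exp\left\{\int_a^t(1+\varepsilon(s))(\beta-1)^{\beta-1}q_C(s)\,ds\right\},$$ and $y\in\mathcal{IS}_{\infty,\infty}$. (ii) If $\int_a^\infty q_C(s)\,ds<\infty$, then $y\in\mathcal{IS}_{B,\infty}$, the limit $N:=\lim_{t\to\infty}y(t)$ lies in $(0,\infty)$, there is a function $\varepsilon$ with $\varepsilon(t)\to0$ as $t\to\infty$ such that, for all large $t$, $$y(t)=N\exp\left\{-\int_t^\infty(1+\varepsilon(s))(\beta-1)^{\beta-1}q_C(s)\,ds\right\},$$ moreover $|y\circ Q^{-1}-N|\in\mathcal{SV}$, and $$\lim_{t\to\infty}\frac{R_C^\alpha(t)\,p(t)\,r^{\beta-1}(t)}{\Phi(y(t)-N)}=0 .$$ -/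

import Mathlib

open Set Filter Topology MeasureTheory

noncomputable section

namespace HalfLinear

/-! Regular variation at infinity. A function `[A, ∞) → ℝ` is represented by a total function
`ℝ → ℝ` of which only the values near infinity are used. -/

/-- `f` is regularly varying (at infinity) of index `θ`: it is measurable and positive on some
half-line `[A, ∞)` and `f (c t) / f t → c ^ θ` for every `c > 0`. -/
def IsRV (f : ℝ → ℝ) (θ : ℝ) : Prop :=
  (∃ A : ℝ, Measurable (fun t : Ici A => f t) ∧ ∀ t ∈ Ici A, 0 < f t) ∧
    ∀ c : ℝ, 0 < c → Tendsto (fun t => f (c * t) / f t) atTop (𝓝 (c ^ θ))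

/-- Slowly varying functions. -/
def IsSV (f : ℝ → ℝ) : Prop := IsRV f 0

/-- Normalized slowly varying functions: `f t = C exp (∫_{t₀}^t ψ(s)/s ds)` for `t ≥ t₀ > 0`, with a
constant `C > 0` and a measurable `ψ` that tends to `0` at infinity. -/
def IsNSV (f : ℝ → ℝ) : Prop :=
  ∃ (t₀ C : ℝ) (ψ : ℝ → ℝ), 0 < t₀ ∧ 0 < C ∧ Measurable ψ ∧ Tendsto ψ atTop (𝓝 0) ∧
    (∀ t ∈ Ici t₀, IntervalIntegrable (fun s => ψ s / s) volume t₀ t) ∧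
    ∀ t ∈ Ici t₀, f t = C * Real.exp (∫ s in t₀..t, ψ s / s)

/-- The slowly varying component `L_f(t) = f(t) / t ^ θ` of a function `f` of index `θ`. -/
def slowPart (f : ℝ → ℝ) (θ : ℝ) (t : ℝ) : ℝ := f t / t ^ θ

/-! The equation `(r(t) Φ(y'))' = p(t) Φ(y(τ(t)))`. -/

/-- `Φ(u) = |u| ^ (α - 1) sgn u`. -/
def Phi (α u : ℝ) : ℝ := |u| ^ (α - 1) * Real.sign u

/-- The quasiderivative `y^[1] = r Φ(y')`. -/
def quasi (α : ℝ) (r y : ℝ → ℝ) (t : ℝ) : ℝ := r t * Phi α (deriv y t)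

/-- `y` is a classical solution of `(r Φ(y'))' = p Φ(y ∘ τ)` on the open half-line `(T, ∞)`. -/
structure IsSolutionOn (α : ℝ) (r p τ y : ℝ → ℝ) (T : ℝ) : Prop where
  contDiffOn : ContDiffOn ℝ 1 y (Ioi T)
  contDiffOn_quasi : ContDiffOn ℝ 1 (quasi α r y) (Ioi T)
  eqn : ∀ t ∈ Ioi T, deriv (quasi α r y) t = p t * Phi α (y (τ t))

/-- The class `𝒮`: positive solutions for large `t`. -/
def classS (a α : ℝ) (r p τ : ℝ → ℝ) : Set (ℝ → ℝ) :=
  {y | ∃ T : ℝ, a ≤ T ∧ IsSolutionOn α r p τ y T ∧ ∀ t ∈ Ioi T, 0 < y t}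

/-- The class `IS`: eventually positive solutions with `y'(t) > 0` for large `t`. -/
def classIS (a α : ℝ) (r p τ : ℝ → ℝ) : Set (ℝ → ℝ) :=
  {y | y ∈ classS a α r p τ ∧ ∀ᶠ t in atTop, 0 < deriv y t}

/-- The subclass `IS_{∞,∞}`: `y → ∞` and `y^[1] → ∞`. -/
def classISInfInf (a α : ℝ) (r p τ : ℝ → ℝ) : Set (ℝ → ℝ) :=
  {y | y ∈ classIS a α r p τ ∧ Tendsto y atTop atTop ∧ Tendsto (quasi α r y) atTop atTop}

/-- The subclass `IS_{B,∞}`: `y` tends to a nonzero real number and `y^[1] → ∞`. -/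
def classISBInf (a α : ℝ) (r p τ : ℝ → ℝ) : Set (ℝ → ℝ) :=
  {y | y ∈ classIS a α r p τ ∧ (∃ b : ℝ, b ≠ 0 ∧ Tendsto y atTop (𝓝 b)) ∧
    Tendsto (quasi α r y) atTop atTop}

/-! The change of variable for convergent `∫_a^∞ r^{1-β}`. -/

/-- `R_C(t) = ∫_t^∞ r^{1-β}(s) ds`. -/
def RC (β : ℝ) (r : ℝ → ℝ) (t : ℝ) : ℝ := ∫ s in Ioi t, r s ^ (1 - β)

/-- `Q = 1 / R_C`. -/
def Q (β : ℝ) (r : ℝ → ℝ) (t : ℝ) : ℝ := 1 / RC β r t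

/-- The inverse `Q⁻¹ : [Q(a), ∞) → [a, ∞)` of `Q` restricted to `[a, ∞)`; its values at arguments
below `Q(a)` are irrelevant. -/
def Qinv (a β : ℝ) (r : ℝ → ℝ) : ℝ → ℝ := Function.invFunOn (Q β r) (Ici a)

/-- `τ_C = Q ∘ τ ∘ Q⁻¹`. -/
def tauC (a β : ℝ) (r τ : ℝ → ℝ) (s : ℝ) : ℝ := Q β r (τ (Qinv a β r s))

/-- `p_C = (R_C² p r^{β-1}) ∘ Q⁻¹`. -/
def pC (a β : ℝ) (r p : ℝ → ℝ) (s : ℝ) : ℝ :=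
  (fun t => RC β r t ^ 2 * p t * r t ^ (β - 1)) (Qinv a β r s)

/-- `q_C = (R_C p r^{β-2})^{β-1}`. -/
def qC (β : ℝ) (r p : ℝ → ℝ) (t : ℝ) : ℝ := (RC β r t * p t * r t ^ (β - 2)) ^ (β - 1)

end HalfLinear

end

namespace HalfLinear

/-! The substitution `s = Q(t)`, `x = y ∘ Q⁻¹` turns the equation into `(s^(2α-2) (x')^(α-1))' =
P(s) x(σ(s))^(α-1)` with `P = p_C` and `σ = τ_C`. If `v` is the quasiderivative, then `v / (s
x)^(α-1) = (s x'/x)^(α-1)`. L'Hôpital's rule, `x(σ(s)) ≤ x(s)` and `L_P → 0` give `s x'/x → 0`, so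
`x` is normalized slowly varying.

Since `σ` is comparable to the identity, it follows that `x(σ(s))/x(s) → 1`. Hence `v'` behaves like
a function of index `α-2 > -1`, and Karamata's theorem gives `s v'/v → α-1`. Combined with the
identity above, `(s x'/x)^(α-1) ~ L_P(s)/(α-1)`. As `(α-1)(β-1) = 1`, this reads `y'/y ~ (β-1)^(β-1)
q_C` in the old variable, and integration gives both exponential formulas and the dichotomy.

In the convergent case `x' = (v / s^(2α-2))^(β-1)` has index `-1`. So `N - x` is slowly varying with
`s x'/(N - x) → 0`, and dividing by the asymptotics of `s x'/x` gives the last limit. -/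

/-! ### Monotonicity and l'Hôpital's rule at infinity. -/

theorem monotoneOn_Ici_of_hasDerivAt {f f' : ℝ → ℝ} {A : ℝ}
    (h : ∀ s, A ≤ s → HasDerivAt f (f' s) s) (h0 : ∀ s, A ≤ s → 0 ≤ f' s) :
    MonotoneOn f (Ici A) :=
  monotoneOn_of_hasDerivWithinAt_nonneg (convex_Ici A)
    (fun s hs => (h s hs).continuousAt.continuousWithinAt)
    (fun s hs => (h s (interior_subset hs)).hasDerivWithinAt)
    (fun s hs => h0 s (interior_subset hs))

theorem strictMonoOn_Ici_of_hasDerivAt {f f' : ℝ → ℝ} {A : ℝ}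
    (h : ∀ s, A ≤ s → HasDerivAt f (f' s) s) (h0 : ∀ s, A ≤ s → 0 < f' s) :
    StrictMonoOn f (Ici A) :=
  strictMonoOn_of_hasDerivWithinAt_pos (convex_Ici A)
    (fun s hs => (h s hs).continuousAt.continuousWithinAt)
    (fun s hs => (h s (interior_subset hs)).hasDerivWithinAt)
    (fun s hs => h0 s (interior_subset hs))

/-- `l V - U` is eventually nondecreasing, so `U ≤ l V + const`, and the constant is absorbed by `(m
- l) V`. Nothing is assumed about the growth of `U`. -/
theorem eventually_div_lt_of_hasDerivAt {U V U' V' : ℝ → ℝ} {l m : ℝ}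
    (hU : ∀ᶠ s in atTop, HasDerivAt U (U' s) s) (hV : ∀ᶠ s in atTop, HasDerivAt V (V' s) s)
    (hV' : ∀ᶠ s in atTop, 0 < V' s) (hVtop : Tendsto V atTop atTop)
    (hl : ∀ᶠ s in atTop, U' s / V' s < l) (hm : l < m) : ∀ᶠ s in atTop, U s / V s < m := by
  obtain ⟨B, hB⟩ := eventually_atTop.1 (hU.and (hV.and (hV'.and hl)))
  have hmono : MonotoneOn (fun s => l * V s - U s) (Ici B) := by
    refine monotoneOn_Ici_of_hasDerivAt (f' := fun s => l * V' s - U' s)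
      (fun s hs => ((hB s hs).2.1.const_mul l).sub (hB s hs).1) fun s hs => ?_
    have := (div_lt_iff₀ (hB s hs).2.2.1).1 (hB s hs).2.2.2
    linarith
  have hlarge := hVtop.eventually_gt_atTop (max 0 ((U B - l * V B) / (m - l)))
  filter_upwards [hlarge, eventually_ge_atTop B] with s hs hsB
  have h0 : 0 < V s := (le_max_left _ _).trans_lt hs
  have h1 : (U B - l * V B) / (m - l) < V s := (le_max_right _ _).trans_lt hs
  have h2 : l * V B - U B ≤ l * V s - U s := hmono self_mem_Ici hsB hsB
  rw [div_lt_iff₀ (by linarith)] at h1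
  rw [div_lt_iff₀ h0]
  linarith

theorem tendsto_div_of_tendsto_deriv_div_atTop {U V U' V' : ℝ → ℝ} {l : ℝ}
    (hU : ∀ᶠ s in atTop, HasDerivAt U (U' s) s) (hV : ∀ᶠ s in atTop, HasDerivAt V (V' s) s)
    (hV' : ∀ᶠ s in atTop, 0 < V' s) (hVtop : Tendsto V atTop atTop)
    (hl : Tendsto (fun s => U' s / V' s) atTop (𝓝 l)) :
    Tendsto (fun s => U s / V s) atTop (𝓝 l) := by
  refine tendsto_order.2 ⟨fun m hm => ?_, fun m hm => ?_⟩
  · obtain ⟨k, hmk, hkl⟩ := exists_between hm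
    have := eventually_div_lt_of_hasDerivAt (U := fun s => -U s) (U' := fun s => -U' s)
      (l := -k) (m := -m) (hU.mono fun s h => h.neg) hV hV' hVtop
      ((hl.eventually_const_lt hkl).mono fun s h => by rw [neg_div]; linarith) (by linarith)
    filter_upwards [this] with s hs
    rw [neg_div] at hs
    linarith
  · obtain ⟨k, hlk, hkm⟩ := exists_between hm
    exact eventually_div_lt_of_hasDerivAt hU hV hV' hVtop (hl.eventually_lt_const hlk) hkm

theorem hasDerivAt_comp_const_mul {V f : ℝ → ℝ} {A c s : ℝ}
    (hV : ∀ s, A ≤ s → HasDerivAt V (f s) s) (h : A ≤ c * s) :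
    HasDerivAt (fun s => V (c * s)) (c * f (c * s)) s := by
  have h1 : HasDerivAt (fun s : ℝ => c * s) c s := by simpa using (hasDerivAt_id s).const_mul c
  have := (hV _ h).comp s h1
  rwa [mul_comm] at this

theorem eventually_le_const_mul {c : ℝ} (hc : 0 < c) (A : ℝ) : ∀ᶠ s in atTop, A ≤ c * s :=
  (tendsto_id.const_mul_atTop hc).eventually_ge_atTop A

/-! ### Karamata theory for primitives and tails. -/

/-- A primitive of a positive function of index greater than `-1` tends to infinity. -/
theorem tendsto_atTop_of_deriv_ratio {V f : ℝ → ℝ} {A ρ : ℝ} (hA : 0 < A)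
    (hV : ∀ s, A ≤ s → HasDerivAt V (f s) s) (hf : ∀ s, A ≤ s → 0 < f s)
    (hratio : Tendsto (fun s => f (2 * s) / f s) atTop (𝓝 (2 ^ ρ))) (hρ : -1 < ρ) :
    Tendsto V atTop atTop := by
  have hmono := strictMonoOn_Ici_of_hasDerivAt hV hf
  have hext : Monotone fun s => V (max s A) := fun s t hst =>
    hmono.monotoneOn (show A ≤ max s A from le_max_right _ _)
      (show A ≤ max t A from le_max_right _ _) (max_le_max_right A hst)
  have heq : (fun s => V (max s A)) =ᶠ[atTop] V := by
    filter_upwards [eventually_ge_atTop A] with s hs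
    rw [max_eq_left hs]
  rcases tendsto_atTop_of_monotone hext with h | ⟨l, h⟩
  · exact h.congr' heq
  exfalso
  replace h := h.congr' heq
  have hdiff : Tendsto (fun s => V (2 * s) - V s) atTop (𝓝 0) := by
    have := (h.comp (tendsto_id.const_mul_atTop (two_pos (α := ℝ)))).sub h
    simpa using this
  have h2 : (1 / 2 : ℝ) < 2 ^ ρ := by
    have := Real.rpow_lt_rpow_of_exponent_lt (x := 2) (by norm_num) hρ
    rwa [Real.rpow_neg_one, ← one_div] at this
  obtain ⟨B, hB⟩ := eventually_atTop.1 (hratio.eventually_const_lt h2)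
  set D := max A B
  have hDA : A ≤ D := le_max_left _ _
  -- If `V` converged, this increment would tend to `0`. But `f(2s)/f(s) > 1/2` eventually, so the
  -- increment is nondecreasing, and it is positive at `D`.
  have hW : MonotoneOn (fun s => V (2 * s) - V s) (Ici D) := by
    refine monotoneOn_Ici_of_hasDerivAt (f' := fun s => 2 * f (2 * s) - f s)
      (fun s hs => (hasDerivAt_comp_const_mul hV (by linarith)).sub (hV s (by linarith)))
      fun s hs => ?_
    have := (lt_div_iff₀ (hf s (by linarith))).1 (hB s ((le_max_right _ _).trans hs))
    linarith
  have hpos : 0 < V (2 * D) - V D :=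
    sub_pos.2 (hmono hDA (show A ≤ 2 * D by linarith) (by linarith))
  have := ge_of_tendsto hdiff ((eventually_ge_atTop D).mono fun s hs => hW self_mem_Ici hs hs)
  exact absurd this (not_le.2 hpos)

/-- Rescaling to the fixed interval `[1, 2]` lets dominated convergence act on increments as `s →
∞`. -/
theorem integral_comp_mul_eq_sub {V f : ℝ → ℝ} {A : ℝ} (hA : 0 < A)
    (hV : ∀ s, A ≤ s → HasDerivAt V (f s) s) (hfc : ContinuousOn f (Ici A)) {s : ℝ} (hs : A ≤ s) :
    ∫ u in (1 : ℝ)..2, s * f (s * u) = V (2 * s) - V s := by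
  have hmem : ∀ u ∈ uIcc (1 : ℝ) 2, A ≤ s * u := fun u hu => by
    rw [uIcc_of_le one_le_two] at hu
    nlinarith [hu.1]
  rw [intervalIntegral.integral_eq_sub_of_hasDerivAt (f := fun u => V (s * u))
    (fun u hu => hasDerivAt_comp_const_mul hV (hmem u hu)), mul_one, mul_comm s 2]
  refine ContinuousOn.intervalIntegrable ?_
  exact continuousOn_const.mul (hfc.comp (by fun_prop) hmem)

/-- A form of Fatou's lemma for increments over `[s, 2 s]`. -/
theorem exists_eventually_mul_le_increment {V f : ℝ → ℝ} {A ρ : ℝ} (hA : 0 < A)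
    (hV : ∀ s, A ≤ s → HasDerivAt V (f s) s) (hf : ∀ s, A ≤ s → 0 < f s)
    (hfc : ContinuousOn f (Ici A))
    (hratio : ∀ c : ℝ, 0 < c → Tendsto (fun s => f (c * s) / f s) atTop (𝓝 (c ^ ρ))) :
    ∃ k : ℝ, 0 < k ∧ ∀ᶠ s in atTop, k * (s * f s) ≤ V (2 * s) - V s := by
  have hcont : ∀ s, A ≤ s → ContinuousOn (fun u => f (s * u) / f s) (Icc 1 2) := fun s hs =>
    (hfc.comp (by fun_prop) fun u hu => by
      have := hu.1
      show A ≤ s * u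
      nlinarith).div_const _
  -- Only pointwise convergence of the ratios is known; truncating at `1` supplies the dominating
  -- function and still bounds the integral from below.
  have hlim : Tendsto (fun s => ∫ u in (1 : ℝ)..2, min (f (s * u) / f s) 1) atTop
      (𝓝 (∫ u in (1 : ℝ)..2, min (u ^ ρ) 1)) := by
    refine intervalIntegral.tendsto_integral_filter_of_dominated_convergence (fun _ => 1) ?_ ?_
      intervalIntegrable_const ?_
    · filter_upwards [eventually_ge_atTop A] with s hs
      rw [uIoc_of_le one_le_two]
      exact (((hcont s hs).inf continuousOn_const).mono Ioc_subset_Icc_self).aestronglyMeasurable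
        measurableSet_Ioc
    · filter_upwards [eventually_ge_atTop A] with s hs
      refine Eventually.of_forall fun u hu => ?_
      rw [uIoc_of_le one_le_two] at hu
      have h1 : 0 < f (s * u) := hf _ (by nlinarith [hu.1])
      rw [Real.norm_of_nonneg (le_min (div_pos h1 (hf s hs)).le zero_le_one)]
      exact min_le_right _ _
    · refine Eventually.of_forall fun u hu => ?_
      rw [uIoc_of_le one_le_two] at hu
      have := (hratio u (by linarith [hu.1])).min (tendsto_const_nhds (x := (1 : ℝ)))
      simpa only [mul_comm u] using this
  have hpos : 0 < ∫ u in (1 : ℝ)..2, min (u ^ ρ) 1 := by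
    refine intervalIntegral.intervalIntegral_pos_of_pos_on ?_ (fun u hu => ?_) one_lt_two
    · refine ContinuousOn.intervalIntegrable ?_
      rw [uIcc_of_le one_le_two]
      exact ContinuousOn.inf (fun u hu => (Real.continuousAt_rpow_const u ρ
        (Or.inl (zero_lt_one.trans_le hu.1).ne')).continuousWithinAt)
        continuousOn_const
    · exact lt_min (Real.rpow_pos_of_pos (by linarith [hu.1]) _) one_pos
  obtain ⟨k, hk0, hk⟩ := exists_between hpos
  refine ⟨k, hk0, ?_⟩
  filter_upwards [hlim.eventually_const_lt hk, eventually_ge_atTop A] with s hks hs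
  have hs0 : 0 < s * f s := mul_pos (hA.trans_le hs) (hf s hs)
  have hc := hcont s hs
  rw [← uIcc_of_le one_le_two] at hc
  have hle : ∫ u in (1 : ℝ)..2, min (f (s * u) / f s) 1 ≤ ∫ u in (1 : ℝ)..2, f (s * u) / f s :=
    intervalIntegral.integral_mono_on one_le_two
      (hc.inf continuousOn_const).intervalIntegrable hc.intervalIntegrable
      fun u _ => min_le_left _ _
  have heq : V (2 * s) - V s = s * f s * ∫ u in (1 : ℝ)..2, f (s * u) / f s := by
    rw [← integral_comp_mul_eq_sub hA hV hfc hs, ← intervalIntegral.integral_const_mul]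
    congr 1 with u
    field_simp [(hf s hs).ne']
  rw [heq, mul_comm k]
  exact mul_le_mul_of_nonneg_left (hks.le.trans hle) hs0.le

theorem tendsto_ratio_of_deriv_ratio {V f : ℝ → ℝ} {A ρ : ℝ}
    (hV : ∀ s, A ≤ s → HasDerivAt V (f s) s) (hf : ∀ s, A ≤ s → 0 < f s)
    (hVtop : Tendsto V atTop atTop)
    (hratio : ∀ c : ℝ, 0 < c → Tendsto (fun s => f (c * s) / f s) atTop (𝓝 (c ^ ρ)))
    {c : ℝ} (hc : 0 < c) : Tendsto (fun s => V (c * s) / V s) atTop (𝓝 (c ^ (ρ + 1))) := by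
  refine tendsto_div_of_tendsto_deriv_div_atTop (U' := fun s => c * f (c * s)) (V' := f)
    ((eventually_le_const_mul hc A).mono fun s hs => hasDerivAt_comp_const_mul hV hs)
    ((eventually_ge_atTop A).mono hV) ((eventually_ge_atTop A).mono hf) hVtop ?_
  have := (hratio c hc).const_mul c
  rw [mul_comm c, ← Real.rpow_add_one hc.ne'] at this
  exact this.congr fun s => by ring

/-- Karamata's theorem, direct half, index greater than `-1`. -/
theorem tendsto_mul_deriv_div_of_ratio {V f : ℝ → ℝ} {A ρ : ℝ} (hA : 0 < A)
    (hV : ∀ s, A ≤ s → HasDerivAt V (f s) s) (hf : ∀ s, A ≤ s → 0 < f s)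
    (hVpos : ∀ s, A ≤ s → 0 < V s) (hfc : ContinuousOn f (Ici A))
    (hratio : ∀ c : ℝ, 0 < c → Tendsto (fun s => f (c * s) / f s) atTop (𝓝 (c ^ ρ)))
    (hρ : -1 < ρ) : Tendsto (fun s => s * f s / V s) atTop (𝓝 (ρ + 1)) := by
  have hVtop := tendsto_atTop_of_deriv_ratio hA hV hf (hratio 2 two_pos) hρ
  have hVr := fun {c : ℝ} (hc : 0 < c) => tendsto_ratio_of_deriv_ratio hV hf hVtop hratio hc
  set b : ℝ → ℝ := fun s => s * f s / V s with hb
  have hbpos : ∀ s, A ≤ s → 0 < b s := fun s hs =>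
    div_pos (mul_pos (hA.trans_le hs) (hf s hs)) (hVpos s hs)
  -- `k s f(s) ≤ V(2s) - V(s)`, and `V(2s)/V(s)` stays below `2^(ρ+1) + 1`.
  obtain ⟨K, hK⟩ : ∃ K, ∀ᶠ s in atTop, b s ≤ K := by
    obtain ⟨k, hk, hkV⟩ := exists_eventually_mul_le_increment hA hV hf hfc hratio
    refine ⟨(2 ^ (ρ + 1) + 1) / k, ?_⟩
    filter_upwards [hkV, (hVr two_pos).eventually_lt_const (lt_add_one _),
      eventually_ge_atTop A] with s h1 h2 hs
    rw [div_lt_iff₀ (hVpos s hs)] at h2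
    rw [hb, div_le_div_iff₀ (hVpos s hs) hk]
    linarith [hVpos s hs]
  obtain ⟨B, hB⟩ := eventually_atTop.1 hK
  have hbr : ∀ c : ℝ, 0 < c → Tendsto (fun s => b (c * s) / b s) atTop (𝓝 1) := fun c hc => by
    have h1 := ((hratio c hc).const_mul c).div (hVr hc) (Real.rpow_pos_of_pos hc _).ne'
    rw [Real.rpow_add_one hc.ne', mul_comm c, div_self (by positivity)] at h1
    refine h1.congr' ?_
    filter_upwards [eventually_le_const_mul hc A, eventually_ge_atTop A] with s h2 h3
    have := (hf s h3).ne'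
    have := (hVpos s h3).ne'
    have := (hVpos _ h2).ne'
    have := (hA.trans_le h3).ne'
    simp only [hb, Pi.div_apply]
    field_simp
  -- Boundedness of `b` upgrades ratio convergence to difference convergence. Since `b(s)/s` is the
  -- derivative of `log V`, `log (V(2s)/V(s))` is the integral of `b(su)/u` over `[1, 2]`; it tends
  -- to `(ρ+1) log 2` and differs from `b(s) log 2` by `o(1)`.
  have hbd : ∀ c : ℝ, 0 < c → Tendsto (fun s => b (c * s) - b s) atTop (𝓝 0) := fun c hc => by
    have h1 : Tendsto (fun s => K * |b (c * s) / b s - 1|) atTop (𝓝 0) := by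
      simpa using (((hbr c hc).sub_const 1).abs).const_mul K
    refine squeeze_zero_norm' ?_ h1
    filter_upwards [eventually_ge_atTop A, hK] with s hs hKs
    have h0 := hbpos s hs
    have : b (c * s) - b s = b s * (b (c * s) / b s - 1) := by field_simp
    rw [this, norm_mul, Real.norm_of_nonneg h0.le, Real.norm_eq_abs]
    gcongr
  have hbc : ContinuousOn b (Ici A) :=
    (continuousOn_id.mul hfc).div (fun s hs => (hV s hs).continuousAt.continuousWithinAt)
      fun s hs => (hVpos s hs).ne'
  have hint1 : ∀ s, A ≤ s → ContinuousOn (fun u => b (s * u) / u) (Icc 1 2) := fun s hs =>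
    (hbc.comp (by fun_prop) fun u hu => by
      have := hu.1
      show A ≤ s * u
      nlinarith).div continuousOn_id fun u hu => by
        have := hu.1
        show u ≠ 0
        linarith
  have hint2 : ∀ k : ℝ, ContinuousOn (fun u : ℝ => k / u) (Icc 1 2) := fun k =>
    continuousOn_const.div continuousOn_id fun u hu => by
      have := hu.1
      show u ≠ 0
      linarith
  have hlim : Tendsto (fun s => ∫ u in (1 : ℝ)..2, (b (s * u) / u - b s / u)) atTop (𝓝 0) := by
    have : (0 : ℝ) = ∫ u in (1 : ℝ)..2, (0 : ℝ) := by simp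
    rw [this]
    refine intervalIntegral.tendsto_integral_filter_of_dominated_convergence (fun _ => K) ?_ ?_
      intervalIntegrable_const ?_
    · filter_upwards [eventually_ge_atTop A] with s hs
      rw [uIoc_of_le one_le_two]
      exact (((hint1 s hs).sub (hint2 _)).mono Ioc_subset_Icc_self).aestronglyMeasurable
        measurableSet_Ioc
    · filter_upwards [eventually_ge_atTop A, eventually_ge_atTop B] with s hs hsB
      refine Eventually.of_forall fun u hu => ?_
      rw [uIoc_of_le one_le_two] at hu
      have hs0 := hA.trans_le hs
      have hsu : s ≤ s * u := by nlinarith [hu.1]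
      have h1 := hbpos _ (hs.trans hsu)
      have h2 := hbpos s hs
      have h3 := hB _ (hsB.trans hsu)
      have h4 := hB _ hsB
      rw [← sub_div, Real.norm_eq_abs, abs_div, abs_of_pos (by linarith [hu.1] : 0 < u),
        div_le_iff₀ (by linarith [hu.1])]
      have : |b (s * u) - b s| ≤ K := abs_le.2 ⟨by linarith, by linarith⟩
      nlinarith [hu.1]
    · refine Eventually.of_forall fun u hu => ?_
      rw [uIoc_of_le one_le_two] at hu
      have := (hbd u (by linarith [hu.1])).div_const u
      simpa only [mul_comm u, sub_div, zero_div] using this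
  have hlog : Tendsto (fun s => Real.log (V (2 * s) / V s)) atTop
      (𝓝 ((ρ + 1) * Real.log 2)) := by
    rw [← Real.log_rpow two_pos]
    exact (hVr two_pos).log (by positivity)
  have heq : ∀ s, A ≤ s → Real.log (V (2 * s) / V s) - b s * Real.log 2 =
      ∫ u in (1 : ℝ)..2, (b (s * u) / u - b s / u) := fun s hs => by
    have hs0 := hA.trans_le hs
    have hi1 := hint1 s hs
    have hi2 := hint2 (b s)
    rw [← uIcc_of_le one_le_two] at hi1 hi2
    rw [intervalIntegral.integral_sub hi1.intervalIntegrable hi2.intervalIntegrable]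
    have e2 : ∫ u in (1 : ℝ)..2, b s / u = b s * Real.log 2 := by
      simp only [div_eq_mul_inv]
      rw [intervalIntegral.integral_const_mul, integral_inv_of_pos one_pos two_pos]
      simp
    rw [e2, intervalIntegral.integral_eq_sub_of_hasDerivAt (f := fun u => Real.log (V (s * u))) ?_
      hi1.intervalIntegrable, mul_one, mul_comm s 2, Real.log_div (hVpos _ (by linarith)).ne'
      (hVpos _ hs).ne']
    intro u hu
    rw [uIcc_of_le one_le_two] at hu
    have hsu : A ≤ s * u := by nlinarith [hu.1]
    have hu0 : 0 < u := by linarith [hu.1]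
    refine ((hasDerivAt_comp_const_mul hV hsu).log (hVpos _ hsu).ne').congr_deriv ?_
    simp only [hb]
    field_simp
  have hfin : Tendsto (fun s => b s * Real.log 2) atTop (𝓝 ((ρ + 1) * Real.log 2)) := by
    have := hlog.sub hlim
    rw [sub_zero] at this
    refine this.congr' ?_
    filter_upwards [eventually_ge_atTop A] with s hs
    rw [← heq s hs]
    ring
  have hl2 : Real.log 2 ≠ 0 := (Real.log_pos one_lt_two).ne'
  have := hfin.div_const (Real.log 2)
  simpa [hl2] using this

/-- Karamata's theorem for tail integrals of functions of index `-1`. -/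
theorem tail_of_ratio_neg_one {G f : ℝ → ℝ} {A : ℝ} (hA : 0 < A)
    (hG : ∀ s, A ≤ s → HasDerivAt G (-f s) s) (hf : ∀ s, A ≤ s → 0 < f s)
    (hfc : ContinuousOn f (Ici A)) (hG0 : Tendsto G atTop (𝓝 0))
    (hratio : ∀ c : ℝ, 0 < c → Tendsto (fun s => f (c * s) / f s) atTop (𝓝 (c ^ (-1 : ℝ)))) :
    (∀ s, A ≤ s → 0 < G s) ∧ (∀ c : ℝ, 0 < c → Tendsto (fun s => G (c * s) / G s) atTop (𝓝 1)) ∧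
      Tendsto (fun s => s * f s / G s) atTop (𝓝 0) := by
  have hG' : ∀ s, A ≤ s → HasDerivAt (fun s => -G s) (f s) s := fun s hs => by
    have := (hG s hs).neg
    rwa [neg_neg] at this
  have hmono := strictMonoOn_Ici_of_hasDerivAt hG' hf
  have hpos : ∀ s, A ≤ s → 0 < G s := fun s hs => by
    have h1 : G (s + 1) < G s := by
      have := hmono (show A ≤ s from hs) (show A ≤ s + 1 by linarith) (lt_add_one s)
      simpa using this
    have h2 : 0 ≤ G (s + 1) := by
      refine le_of_tendsto hG0 ((eventually_ge_atTop (s + 1)).mono fun t ht => ?_)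
      have := hmono.monotoneOn (show A ≤ s + 1 by linarith) (show A ≤ t by linarith) ht
      simpa using this
    linarith
  have hr : ∀ c : ℝ, 0 < c → Tendsto (fun s => G (c * s) / G s) atTop (𝓝 1) := fun c hc => by
    refine HasDerivAt.lhopital_zero_atTop (f' := fun s => c * -f (c * s)) (g' := fun s => -f s)
      ((eventually_le_const_mul hc A).mono fun s hs =>
        hasDerivAt_comp_const_mul (f := fun s => -f s) hG hs)
      ((eventually_ge_atTop A).mono hG)
      ((eventually_ge_atTop A).mono fun s hs => neg_ne_zero.2 (hf s hs).ne')
      (hG0.comp (tendsto_id.const_mul_atTop hc)) hG0 ?_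
    have := (hratio c hc).const_mul c
    rw [Real.rpow_neg_one, mul_inv_cancel₀ hc.ne'] at this
    exact this.congr fun s => by rw [mul_neg, neg_div_neg_eq, mul_div_assoc]
  refine ⟨hpos, hr, ?_⟩
  -- Applied to `-G`, this gives `k s f(s) ≤ G(s) - G(2s)`, which is `o(G(s))` because `G(2s)/G(s) →
  -- 1`.
  obtain ⟨k, hk, hkG⟩ := exists_eventually_mul_le_increment hA hG' hf hfc hratio
  have hlim : Tendsto (fun s => (1 - G (2 * s) / G s) / k) atTop (𝓝 0) := by
    have := ((hr 2 two_pos).const_sub 1).div_const k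
    simpa using this
  refine squeeze_zero' ?_ ?_ hlim
  · filter_upwards [eventually_ge_atTop A] with s hs
    exact (div_pos (mul_pos (hA.trans_le hs) (hf s hs)) (hpos s hs)).le
  · filter_upwards [eventually_ge_atTop A, hkG] with s hs h
    have := hpos s hs
    rw [le_div_iff₀ hk, div_mul_eq_mul_div, div_le_iff₀ this, sub_mul, div_mul_cancel₀ _ this.ne']
    linarith

/-- If the logarithmic derivative of `x` is `o(1 / s)`, then `x (σ s) / x s → 1` for every `σ` that
is comparable to the identity. -/
theorem tendsto_comp_div_of_logDeriv {x x' σ : ℝ → ℝ} {A M : ℝ} (hA : 0 < A)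
    (hx : ∀ s, A ≤ s → HasDerivAt x (x' s) s) (hxpos : ∀ s, A ≤ s → 0 < x s)
    (hψ : Tendsto (fun s => s * x' s / x s) atTop (𝓝 0)) (hM : 0 < M)
    (h1 : ∀ᶠ s in atTop, s ≤ M * σ s) (h2 : ∀ᶠ s in atTop, σ s ≤ M * s) :
    Tendsto (fun s => x (σ s) / x s) atTop (𝓝 1) := by
  have hσ : Tendsto σ atTop atTop := by
    have : Tendsto (fun s => M⁻¹ * s) atTop atTop := tendsto_id.const_mul_atTop (inv_pos.2 hM)
    refine tendsto_atTop_mono' _ (h1.mono fun s hs => ?_) this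
    rwa [inv_mul_le_iff₀ hM]
  set C := |Real.log M| + 1
  have hC : 0 < C := by positivity
  have hlog : Tendsto (fun s => Real.log (x (σ s)) - Real.log (x s)) atTop (𝓝 0) := by
    rw [Metric.tendsto_nhds]
    intro ε hε
    have hε' : 0 < ε / C := div_pos hε hC
    have hψ' := hψ.norm
    rw [norm_zero] at hψ'
    obtain ⟨B, hB⟩ := eventually_atTop.1 (hψ'.eventually_lt_const hε')
    set D := max A B
    have hD0 : 0 < D := hA.trans_le (le_max_left _ _)
    have hl : ∀ s, D ≤ s → HasDerivAt (fun s => Real.log (x s)) (x' s / x s) s := fun s hs =>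
      (hx s ((le_max_left _ _).trans hs)).log (hxpos s ((le_max_left _ _).trans hs)).ne'
    have hln : ∀ s, D ≤ s → HasDerivAt (fun s => ε / C * Real.log s) (ε / C * s⁻¹) s := fun s hs =>
      (Real.hasDerivAt_log (hD0.trans_le hs).ne').const_mul _
    have hbd : ∀ s, D ≤ s → |x' s / x s| ≤ ε / C * s⁻¹ := fun s hs => by
      have h := (hB s ((le_max_right _ _).trans hs)).le
      have hs0 := hD0.trans_le hs
      rw [Real.norm_eq_abs, mul_div_assoc, abs_mul, abs_of_pos hs0] at h
      rw [← div_eq_mul_inv, le_div_iff₀ hs0]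
      linarith
    -- `m1` and `m2` say that `log x` is Lipschitz in `log s` with constant `ε / C`, while `|log
    -- σ(s) - log s| ≤ |log M| < C`.
    have m1 : MonotoneOn (fun s => ε / C * Real.log s - Real.log (x s)) (Ici D) :=
      monotoneOn_Ici_of_hasDerivAt (fun s hs => (hln s hs).sub (hl s hs))
        fun s hs => by linarith [(abs_le.1 (hbd s hs)).2]
    have m2 : MonotoneOn (fun s => ε / C * Real.log s + Real.log (x s)) (Ici D) :=
      monotoneOn_Ici_of_hasDerivAt (fun s hs => (hln s hs).add (hl s hs))
        fun s hs => by linarith [(abs_le.1 (hbd s hs)).1]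
    filter_upwards [h1, h2, eventually_ge_atTop D, hσ.eventually_ge_atTop D] with s k1 k2 k3 k4
    have hs0 := hD0.trans_le k3
    have hσ0 := hD0.trans_le k4
    have e1 := Real.log_le_log hs0 k1
    have e2 := Real.log_le_log hσ0 k2
    rw [Real.log_mul hM.ne' hσ0.ne'] at e1
    rw [Real.log_mul hM.ne' hs0.ne'] at e2
    have e3 := le_abs_self (Real.log M)
    have key : ε / C * |Real.log M| < ε := by
      rw [div_mul_eq_mul_div, div_lt_iff₀ hC]
      have : |Real.log M| < C := lt_add_one _
      nlinarith
    rw [dist_zero_right, Real.norm_eq_abs]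
    rcases le_total s (σ s) with h | h
    · have a1 := m1 (show s ∈ Ici D from k3) (show σ s ∈ Ici D from k4) h
      have a2 := m2 (show s ∈ Ici D from k3) (show σ s ∈ Ici D from k4) h
      have a3 : ε / C * (Real.log (σ s) - Real.log s) ≤ ε / C * |Real.log M| :=
        mul_le_mul_of_nonneg_left (by linarith) hε'.le
      simp only at a1 a2
      exact abs_lt.2 ⟨by linarith, by linarith⟩
    · have a1 := m1 (show σ s ∈ Ici D from k4) (show s ∈ Ici D from k3) h
      have a2 := m2 (show σ s ∈ Ici D from k4) (show s ∈ Ici D from k3) h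
      have a3 : ε / C * (Real.log s - Real.log (σ s)) ≤ ε / C * |Real.log M| :=
        mul_le_mul_of_nonneg_left (by linarith) hε'.le
      simp only at a1 a2
      exact abs_lt.2 ⟨by linarith, by linarith⟩
  have hexp := (Real.continuous_exp.tendsto 0).comp hlog
  rw [Real.exp_zero] at hexp
  refine hexp.congr' ?_
  filter_upwards [eventually_ge_atTop A, hσ.eventually_ge_atTop A] with s k1 k2
  simp only [Function.comp_apply]
  rw [Real.exp_sub, Real.exp_log (hxpos _ k2), Real.exp_log (hxpos _ k1)]

/-! ### Asymptotics for the transformed equation. -/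

/-- The equation `(s ^ (2 α - 2) (x') ^ (α - 1))' = P(s) x(σ(s)) ^ (α - 1)` on `[A, ∞)` for a positive
increasing function `x`, where `v` is the quasiderivative, `σ` is a delay of linear growth and
`P` is of index `α - 2`, with slowly varying part tending to `0`. -/
structure IsTransformedSolution (α A M : ℝ) (P σ x x' v : ℝ → ℝ) : Prop where
  one_lt : 1 < α
  start_pos : 0 < A
  growth_pos : 0 < M
  hasDerivAt : ∀ s, A ≤ s → HasDerivAt x (x' s) s
  pos : ∀ s, A ≤ s → 0 < x s
  deriv_pos : ∀ s, A ≤ s → 0 < x' s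
  quasi_eq : ∀ s, A ≤ s → v s = s ^ (2 * α - 2) * x' s ^ (α - 1)
  quasi_hasDerivAt : ∀ s, A ≤ s → HasDerivAt v (P s * x (σ s) ^ (α - 1)) s
  continuousOn : ContinuousOn (fun s => P s * x (σ s) ^ (α - 1)) (Ici A)
  coeff_pos : ∀ s, A ≤ s → 0 < P s
  delay_pos : ∀ s, A ≤ s → 0 < x (σ s)
  delay_le : ∀ s, A ≤ s → x (σ s) ≤ x s
  le_mul_delay : ∀ᶠ s in atTop, s ≤ M * σ s
  delay_le_mul : ∀ᶠ s in atTop, σ s ≤ M * s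
  slowPart_tendsto : Tendsto (fun s => P s / s ^ (α - 2)) atTop (𝓝 0)
  ratio : ∀ c : ℝ, 0 < c → Tendsto (fun s => P (c * s) / P s) atTop (𝓝 (c ^ (α - 2)))

namespace IsTransformedSolution

variable {α A M : ℝ} {P σ x x' v : ℝ → ℝ} (h : IsTransformedSolution α A M P σ x x' v)
include h

theorem quasi_pos {s : ℝ} (hs : A ≤ s) : 0 < v s := by
  rw [h.quasi_eq s hs]
  exact mul_pos (Real.rpow_pos_of_pos (h.start_pos.trans_le hs) _)
    (Real.rpow_pos_of_pos (h.deriv_pos s hs) _)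

theorem monotoneOn : MonotoneOn x (Ici A) :=
  monotoneOn_Ici_of_hasDerivAt h.hasDerivAt fun s hs => (h.deriv_pos s hs).le

/-- One of the two factors `s^(α-1)` of the weight cancels; the other joins `x'`. This is what makes
`(s x)^(α-1)` the right comparison function for `v`. -/
theorem quasi_div {s : ℝ} (hs : A ≤ s) :
    v s / (s * x s) ^ (α - 1) = (s * x' s / x s) ^ (α - 1) := by
  have hs0 := h.start_pos.trans_le hs
  have hx0 := h.pos s hs
  have hx'0 := h.deriv_pos s hs
  rw [h.quasi_eq s hs, Real.div_rpow (by positivity) hx0.le, Real.mul_rpow hs0.le hx0.le,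
    Real.mul_rpow hs0.le hx'0.le, show 2 * α - 2 = (α - 1) + (α - 1) by ring, Real.rpow_add hs0]
  have := (Real.rpow_pos_of_pos hs0 (α - 1)).ne'
  have := (Real.rpow_pos_of_pos hx0 (α - 1)).ne'
  field_simp

/-- L'Hôpital's rule for `v / (s x)^(α-1)`: dropping the nonnegative `s x'` term bounds the
derivative of the denominator below by `(α-1) s^(α-2) x^(α-1)`, and `x(σ(s)) ≤ x(s)` bounds `v'`
above by `P x^(α-1)`. The quotient is at most `L_P / (α-1)`, which tends to `0`. -/
theorem rpow_logDeriv_tendsto :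
    Tendsto (fun s => (s * x' s / x s) ^ (α - 1)) atTop (𝓝 0) := by
  have hα := h.one_lt
  have hV : ∀ s, A ≤ s → HasDerivAt (fun s => (s * x s) ^ (α - 1))
      ((1 * x s + s * x' s) * (α - 1) * (s * x s) ^ (α - 1 - 1)) s := fun s hs =>
    ((hasDerivAt_id s).mul (h.hasDerivAt s hs)).rpow_const
      (Or.inl (mul_pos (h.start_pos.trans_le hs) (h.pos s hs)).ne')
  have hV' : ∀ s, A ≤ s →
      (α - 1) * (s ^ (α - 2) * x s ^ (α - 1)) ≤
        (1 * x s + s * x' s) * (α - 1) * (s * x s) ^ (α - 1 - 1) := fun s hs => by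
    have hs0 := h.start_pos.trans_le hs
    have hx0 := h.pos s hs
    have hx'0 := h.deriv_pos s hs
    rw [Real.mul_rpow hs0.le hx0.le, show α - 1 - 1 = α - 2 by ring]
    have e : x s ^ (α - 1) = x s ^ (α - 2) * x s := by
      rw [← Real.rpow_add_one hx0.ne', show α - 2 + 1 = α - 1 by ring]
    rw [e]
    have : 0 ≤ s * x' s * ((α - 1) * (s ^ (α - 2) * x s ^ (α - 2))) :=
      mul_nonneg (mul_pos hs0 hx'0).le (mul_nonneg (by linarith) (by positivity))
    nlinarith
  have hpos : ∀ s, A ≤ s → 0 < (α - 1) * (s ^ (α - 2) * x s ^ (α - 1)) := fun s hs => by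
    have hs0 := h.start_pos.trans_le hs
    have hx0 := h.pos s hs
    exact mul_pos (by linarith) (by positivity)
  have hVtop : Tendsto (fun s => (s * x s) ^ (α - 1)) atTop atTop := by
    refine (tendsto_rpow_atTop (by linarith)).comp ?_
    refine tendsto_atTop_mono' _ ?_ (tendsto_id.atTop_mul_const (h.pos A le_rfl))
    filter_upwards [eventually_ge_atTop A] with s hs
    exact mul_le_mul_of_nonneg_left (h.monotoneOn self_mem_Ici hs hs) (h.start_pos.trans_le hs).le
  have key := tendsto_div_of_tendsto_deriv_div_atTop (l := 0)
    ((eventually_ge_atTop A).mono h.quasi_hasDerivAt) ((eventually_ge_atTop A).mono hV)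
    ((eventually_ge_atTop A).mono fun s hs => (hpos s hs).trans_le (hV' s hs)) hVtop ?_
  · exact key.congr' ((eventually_ge_atTop A).mono fun s hs => h.quasi_div hs)
  · have hlim := h.slowPart_tendsto.div_const (α - 1)
    rw [zero_div] at hlim
    refine squeeze_zero' ?_ ?_ hlim
    · filter_upwards [eventually_ge_atTop A] with s hs
      exact div_nonneg (mul_nonneg (h.coeff_pos s hs).le
        (Real.rpow_nonneg (h.delay_pos s hs).le _)) ((hpos s hs).trans_le (hV' s hs)).le
    · filter_upwards [eventually_ge_atTop A] with s hs
      have hs0 := h.start_pos.trans_le hs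
      have hx0 := h.pos s hs
      calc _ ≤ P s * x s ^ (α - 1) / ((α - 1) * (s ^ (α - 2) * x s ^ (α - 1))) := by
            refine div_le_div₀ (mul_nonneg (h.coeff_pos s hs).le (by positivity)) ?_ (hpos s hs)
              (hV' s hs)
            exact mul_le_mul_of_nonneg_left (Real.rpow_le_rpow (h.delay_pos s hs).le
              (h.delay_le s hs) (by linarith)) (h.coeff_pos s hs).le
        _ = _ := by
            have := (Real.rpow_pos_of_pos hs0 (α - 2)).ne'
            have := (Real.rpow_pos_of_pos hx0 (α - 1)).ne'
            have : α - 1 ≠ 0 := by linarith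
            field_simp

theorem logDeriv_pos {s : ℝ} (hs : A ≤ s) : 0 < s * x' s / x s :=
  div_pos (mul_pos (h.start_pos.trans_le hs) (h.deriv_pos s hs)) (h.pos s hs)

theorem logDeriv_tendsto : Tendsto (fun s => s * x' s / x s) atTop (𝓝 0) := by
  have hα : 0 < α - 1 := by linarith [h.one_lt]
  have := h.rpow_logDeriv_tendsto.rpow_const (p := (α - 1)⁻¹) (Or.inr (inv_pos.2 hα).le)
  rw [Real.zero_rpow (inv_pos.2 hα).ne'] at this
  refine this.congr' ((eventually_ge_atTop A).mono fun s hs => ?_)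
  exact Real.rpow_rpow_inv (h.logDeriv_pos hs).le hα.ne'

theorem comp_div_tendsto {g : ℝ → ℝ} {K : ℝ} (hK : 0 < K) (h1 : ∀ᶠ s in atTop, s ≤ K * g s)
    (h2 : ∀ᶠ s in atTop, g s ≤ K * s) : Tendsto (fun s => x (g s) / x s) atTop (𝓝 1) :=
  tendsto_comp_div_of_logDeriv h.start_pos h.hasDerivAt h.pos h.logDeriv_tendsto hK h1 h2

theorem delay_div_tendsto : Tendsto (fun s => x (σ s) / x s) atTop (𝓝 1) :=
  h.comp_div_tendsto h.growth_pos h.le_mul_delay h.delay_le_mul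

theorem comp_mul_div_tendsto {c : ℝ} (hc : 0 < c) :
    Tendsto (fun s => x (c * s) / x s) atTop (𝓝 1) := by
  refine h.comp_div_tendsto (K := max c c⁻¹) (hc.trans_le (le_max_left _ _)) ?_ ?_
  · filter_upwards [eventually_ge_atTop 0] with s hs
    have : c⁻¹ * (c * s) ≤ max c c⁻¹ * (c * s) :=
      mul_le_mul_of_nonneg_right (le_max_right _ _) (by positivity)
    rwa [inv_mul_cancel_left₀ hc.ne'] at this
  · filter_upwards [eventually_ge_atTop 0] with s hs
    exact mul_le_mul_of_nonneg_right (le_max_left _ _) hs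

theorem rhs_pos {s : ℝ} (hs : A ≤ s) : 0 < P s * x (σ s) ^ (α - 1) :=
  mul_pos (h.coeff_pos s hs) (Real.rpow_pos_of_pos (h.delay_pos s hs) _)

/-- The factor `x(σ(s))^(α-1)` is asymptotically unchanged under `s ↦ c s`, so the right-hand side
inherits the index `α-2` of `P`. This index exceeds `-1`, which opens the way to Karamata's theorem
for `v`. -/
theorem rhs_ratio {c : ℝ} (hc : 0 < c) :
    Tendsto (fun s => P (c * s) * x (σ (c * s)) ^ (α - 1) / (P s * x (σ s) ^ (α - 1))) atTop
      (𝓝 (c ^ (α - 2))) := by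
  have hc' : Tendsto (fun s : ℝ => c * s) atTop atTop := tendsto_id.const_mul_atTop hc
  have h1 := (((h.delay_div_tendsto.comp hc').mul (h.comp_mul_div_tendsto hc)).div
    h.delay_div_tendsto one_ne_zero).rpow_const (p := α - 1) (Or.inl (by norm_num))
  have h2 := (h.ratio c hc).mul h1
  norm_num at h2
  refine h2.congr' ?_
  filter_upwards [eventually_ge_atTop A, hc'.eventually_ge_atTop A] with s k1 k2
  have p1 := h.pos s k1
  have p2 := h.pos _ k2
  have q1 := h.delay_pos s k1
  have q2 := h.delay_pos _ k2
  have e : x (σ (c * s)) / x (c * s) * (x (c * s) / x s) / (x (σ s) / x s) =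
      x (σ (c * s)) / x (σ s) := by
    field_simp
  rw [e, Real.div_rpow q2.le q1.le, div_mul_div_comm]

theorem quasi_tendsto_atTop : Tendsto v atTop atTop :=
  tendsto_atTop_of_deriv_ratio h.start_pos h.quasi_hasDerivAt (fun _ hs => h.rhs_pos hs)
    (h.rhs_ratio two_pos) (by linarith [h.one_lt])

theorem quasi_ratio {c : ℝ} (hc : 0 < c) :
    Tendsto (fun s => v (c * s) / v s) atTop (𝓝 (c ^ (α - 1))) := by
  have := tendsto_ratio_of_deriv_ratio h.quasi_hasDerivAt (fun _ hs => h.rhs_pos hs)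
    h.quasi_tendsto_atTop (fun _ hc => h.rhs_ratio hc) hc
  rwa [show α - 2 + 1 = α - 1 by ring] at this

theorem mul_rhs_div_quasi_tendsto :
    Tendsto (fun s => s * (P s * x (σ s) ^ (α - 1)) / v s) atTop (𝓝 (α - 1)) := by
  have := tendsto_mul_deriv_div_of_ratio h.start_pos h.quasi_hasDerivAt (fun _ hs => h.rhs_pos hs)
    (fun _ hs => h.quasi_pos hs) h.continuousOn (fun _ hc => h.rhs_ratio hc)
    (by linarith [h.one_lt])
  rwa [show α - 2 + 1 = α - 1 by ring] at this

/-- The quotient equals `(x(σ(s))/x(s))^(α-1)` divided by `s v'/v`, whose limits are `1` and `α-1`.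
-/
theorem rpow_logDeriv_div_tendsto :
    Tendsto (fun s => (s * x' s / x s) ^ (α - 1) / (P s / s ^ (α - 2))) atTop
      (𝓝 (α - 1)⁻¹) := by
  have hα := h.one_lt
  have := (h.delay_div_tendsto.rpow_const (p := α - 1) (Or.inl one_ne_zero)).div
    h.mul_rhs_div_quasi_tendsto (by linarith)
  rw [Real.one_rpow, one_div] at this
  refine this.congr' ?_
  filter_upwards [eventually_ge_atTop A] with s hs
  have hs0 := h.start_pos.trans_le hs
  have hx0 := h.pos s hs
  have hq0 := h.delay_pos s hs
  have hv := (h.quasi_pos hs).ne'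
  have hP := (h.coeff_pos s hs).ne'
  simp only [Pi.div_apply]
  rw [← h.quasi_div hs, Real.div_rpow hq0.le hx0.le, Real.mul_rpow hs0.le hx0.le,
    show α - 1 = α - 2 + 1 by ring, Real.rpow_add_one hs0.ne']
  have := (Real.rpow_pos_of_pos hs0 (α - 2)).ne'
  have := (Real.rpow_pos_of_pos hx0 (α - 2 + 1)).ne'
  have := (Real.rpow_pos_of_pos hq0 (α - 2 + 1)).ne'
  field_simp

theorem logDeriv_div_tendsto :
    Tendsto (fun s => (s * x' s / x s) / (P s / s ^ (α - 2)) ^ (α - 1)⁻¹) atTop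
      (𝓝 ((α - 1)⁻¹ ^ (α - 1)⁻¹)) := by
  have hα : 0 < α - 1 := by linarith [h.one_lt]
  have := h.rpow_logDeriv_div_tendsto.rpow_const (p := (α - 1)⁻¹) (Or.inr (inv_pos.2 hα).le)
  refine this.congr' ((eventually_ge_atTop A).mono fun s hs => ?_)
  have hl := (h.logDeriv_pos hs).le
  rw [Real.div_rpow (Real.rpow_nonneg hl _) (div_nonneg (h.coeff_pos s hs).le
    (Real.rpow_nonneg (h.start_pos.trans_le hs).le _)), Real.rpow_rpow_inv hl hα.ne']

theorem deriv_eq {s : ℝ} (hs : A ≤ s) : x' s = (v s / s ^ (2 * α - 2)) ^ (α - 1)⁻¹ := by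
  have hα : 0 < α - 1 := by linarith [h.one_lt]
  rw [h.quasi_eq s hs, mul_div_cancel_left₀ _
    (Real.rpow_pos_of_pos (h.start_pos.trans_le hs) _).ne',
    Real.rpow_rpow_inv (h.deriv_pos s hs).le hα.ne']

/-- Solving for `x'` in terms of the differentiable function `v` gives continuity without a further
hypothesis on `x`. -/
theorem continuousOn_deriv : ContinuousOn x' (Ici A) := by
  have hα : 0 < α - 1 := by linarith [h.one_lt]
  have : ContinuousOn (fun s => (v s / s ^ (2 * α - 2)) ^ (α - 1)⁻¹) (Ici A) := by
    refine ContinuousOn.rpow_const (ContinuousOn.div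
      (fun s hs => (h.quasi_hasDerivAt s hs).continuousAt.continuousWithinAt)
      (continuousOn_id.rpow_const fun s hs => Or.inl (h.start_pos.trans_le hs).ne')
      fun s hs => (Real.rpow_pos_of_pos (h.start_pos.trans_le hs) _).ne') ?_
    exact fun s hs => Or.inr (inv_pos.2 hα).le
  exact this.congr fun s hs => h.deriv_eq hs

/-- `v` has index `α-1`, so `x'` has index `((α-1) - (2α-2))/(α-1) = -1`. -/
theorem deriv_ratio {c : ℝ} (hc : 0 < c) :
    Tendsto (fun s => x' (c * s) / x' s) atTop (𝓝 (c ^ (-1 : ℝ))) := by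
  have hα : 0 < α - 1 := by linarith [h.one_lt]
  have h1 := ((h.quasi_ratio hc).div_const (c ^ (2 * α - 2))).rpow_const (p := (α - 1)⁻¹)
    (Or.inr (inv_pos.2 hα).le)
  rw [← Real.rpow_sub hc, ← Real.rpow_mul hc.le, show (α - 1 - (2 * α - 2)) * (α - 1)⁻¹ = -1 by
    field_simp
    ring] at h1
  refine h1.congr' ?_
  filter_upwards [eventually_ge_atTop A, eventually_le_const_mul hc A] with s k1 k2
  have hs0 := h.start_pos.trans_le k1
  have v1 := h.quasi_pos k1
  have v2 := h.quasi_pos k2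
  have r1 := Real.rpow_pos_of_pos hs0 (2 * α - 2)
  have r2 := Real.rpow_pos_of_pos hc (2 * α - 2)
  rw [h.deriv_eq k1, h.deriv_eq k2, ← Real.div_rpow (by positivity) (by positivity),
    Real.mul_rpow hc.le hs0.le]
  congr 1
  field_simp

/-- `N - x` is the tail of a function of index `-1`, so `s x'/(N - x) → 0`. Dividing by `x → N`,
raising to the power `α-1` and trading `(s x'/x)^(α-1)` for `L_P` gives the last limit. -/
theorem sub_limit {N : ℝ} (hN : Tendsto x atTop (𝓝 N)) :
    (∀ s, A ≤ s → x s < N) ∧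
    (∀ c : ℝ, 0 < c → Tendsto (fun s => (N - x (c * s)) / (N - x s)) atTop (𝓝 1)) ∧
    Tendsto (fun s => P s / s ^ (α - 2) / (N - x s) ^ (α - 1)) atTop (𝓝 0) := by
  have hα : 0 < α - 1 := by linarith [h.one_lt]
  have hN0 : Tendsto (fun s => N - x s) atTop (𝓝 0) := by simpa using hN.const_sub N
  obtain ⟨k1, k2, k3⟩ := tail_of_ratio_neg_one (G := fun s => N - x s) h.start_pos
    (fun s hs => (h.hasDerivAt s hs).const_sub N) h.deriv_pos h.continuousOn_deriv hN0
    fun c hc => h.deriv_ratio hc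
  refine ⟨fun s hs => sub_pos.1 (k1 s hs), k2, ?_⟩
  have hNpos : 0 < N := (h.pos A le_rfl).trans (sub_pos.1 (k1 A le_rfl))
  have l1 := (k3.div hN hNpos.ne').rpow_const (p := α - 1) (Or.inr hα.le)
  have l2 := l1.div h.rpow_logDeriv_div_tendsto (inv_pos.2 hα).ne'
  rw [zero_div, Real.zero_rpow hα.ne', zero_div] at l2
  refine l2.congr' ((eventually_ge_atTop A).mono fun s hs => ?_)
  have hs0 := h.start_pos.trans_le hs
  have hx0 := h.pos s hs
  have hx'0 := h.deriv_pos s hs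
  have hn0 := k1 s hs
  have hP := h.coeff_pos s hs
  simp only [Pi.div_apply] at hn0 ⊢
  have e : s * x' s / (N - x s) / x s = s * x' s / x s / (N - x s) := by field_simp
  have r1 := (Real.rpow_pos_of_pos hs0 (α - 2)).ne'
  have r2 := (Real.rpow_pos_of_pos hn0 (α - 1)).ne'
  have r3 := (Real.rpow_pos_of_pos (h.logDeriv_pos hs) (α - 1)).ne'
  rw [e, Real.div_rpow (h.logDeriv_pos hs).le hn0.le]
  set w := (s * x' s / x s) ^ (α - 1)
  field_simp

end IsTransformedSolution

/-! ### Integral representations from an asymptotic derivative. -/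

/-- The half-open interval matters: the integrands below are defined piecewise and may disagree at
the left endpoint `t₀`. -/
theorem integral_congr_uIoc {f g : ℝ → ℝ} {a b : ℝ} (h : EqOn f g (uIoc a b)) :
    ∫ s in a..b, f s = ∫ s in a..b, g s :=
  intervalIntegral.integral_congr_ae (ae_of_all _ fun _ hs => h hs)

section Primitives

variable {a t₀ K : ℝ} {q g ℓ : ℝ → ℝ}

theorem tendsto_ite_div_sub_one {c : ℝ} (hK : 0 < K)
    (hlim : Tendsto (fun t => g t / q t) atTop (𝓝 K)) :
    Tendsto (fun t => (if t₀ < t then g t / (K * q t) else c) - 1) atTop (𝓝 0) := by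
  have := (hlim.div_const K).sub_const 1
  rw [div_self hK.ne', sub_self] at this
  refine this.congr' ((eventually_gt_atTop t₀).mono fun t ht => ?_)
  simp only
  rw [if_pos ht, div_div, mul_comm K]

theorem one_add_mul_eq_ite {c t : ℝ} (hK : 0 < K) (hqt : 0 < q t) :
    (1 + ((if t₀ < t then g t / (K * q t) else c) - 1)) * K * q t =
      if t₀ < t then g t else c * K * q t := by
  split_ifs
  · field_simp
    ring
  · ring

/-- A primitive of a function that is asymptotic to `K q` as a primitive of `(1 + ε) K q`. -/
theorem exists_eq_integral_one_add (hat : a < t₀) (hK : 0 < K) (hq : ContinuousOn q (Ici a))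
    (hqpos : ∀ t ∈ Ici a, 0 < q t) (hℓ : ∀ t, t₀ ≤ t → HasDerivAt ℓ (g t) t)
    (hg : ContinuousOn g (Ici t₀)) (hlim : Tendsto (fun t => g t / q t) atTop (𝓝 K)) :
    ∃ ε : ℝ → ℝ, Tendsto ε atTop (𝓝 0) ∧
      (∀ t ∈ Ici a, IntervalIntegrable (fun s => (1 + ε s) * K * q s) volume a t) ∧
      ∀ t, t₀ ≤ t → ℓ t = ∫ s in a..t, (1 + ε s) * K * q s := by
  have hqi : ∀ t ∈ Ici a, IntervalIntegrable q volume a t := fun t ht =>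
    (hq.mono (by rw [uIcc_of_le ht]; exact Icc_subset_Ici_self)).intervalIntegrable
  have hgi : ∀ t, t₀ ≤ t → IntervalIntegrable g volume t₀ t := fun t ht =>
    (hg.mono (by rw [uIcc_of_le ht]; exact Icc_subset_Ici_self)).intervalIntegrable
  have hI : 0 < ∫ s in a..t₀, q s :=
    intervalIntegral.intervalIntegral_pos_of_pos_on (hqi t₀ hat.le) (fun s hs => hqpos s hs.1.le)
      hat
  -- The constant value of `1 + ε` on `(a, t₀]`, chosen so that the integral over this interval is
  -- exactly `ℓ t₀`; only the behaviour of `ε` at infinity is constrained.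
  set c := ℓ t₀ / (K * ∫ s in a..t₀, q s) with hc
  set ε : ℝ → ℝ := fun t => (if t₀ < t then g t / (K * q t) else c) - 1 with hε
  have e1 : ∀ t, a ≤ t → t ≤ t₀ → EqOn (fun s => c * K * q s) (fun s => (1 + ε s) * K * q s)
      (uIoc a t) := fun t h1 h2 s hs => by
    rw [uIoc_of_le h1] at hs
    simp only [hε]
    rw [one_add_mul_eq_ite hK (hqpos s hs.1.le), if_neg (not_lt.2 (hs.2.trans h2))]
  have e2 : ∀ t, t₀ ≤ t → EqOn g (fun s => (1 + ε s) * K * q s) (uIoc t₀ t) := fun t h1 s hs => by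
    rw [uIoc_of_le h1] at hs
    simp only [hε]
    rw [one_add_mul_eq_ite hK (hqpos s (hat.trans hs.1).le), if_pos hs.1]
  have i1 : ∀ t, a ≤ t → t ≤ t₀ →
      IntervalIntegrable (fun s => (1 + ε s) * K * q s) volume a t := fun t h1 h2 =>
    ((hqi t h1).const_mul (c * K)).congr (e1 t h1 h2)
  have i2 : ∀ t, t₀ ≤ t →
      IntervalIntegrable (fun s => (1 + ε s) * K * q s) volume t₀ t := fun t h1 =>
    (hgi t h1).congr (e2 t h1)
  refine ⟨ε, tendsto_ite_div_sub_one hK hlim, fun t ht => ?_, fun t ht => ?_⟩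
  · rcases le_total t t₀ with h | h
    · exact i1 t ht h
    · exact (i1 t₀ hat.le le_rfl).trans (i2 t h)
  · rw [← intervalIntegral.integral_add_adjacent_intervals (i1 t₀ hat.le le_rfl) (i2 t ht),
      ← integral_congr_uIoc (e1 t₀ hat.le le_rfl),
      ← integral_congr_uIoc (e2 t ht),
      intervalIntegral.integral_const_mul, intervalIntegral.integral_eq_sub_of_hasDerivAt
        (fun s hs => hℓ s (by rw [uIcc_of_le ht] at hs; exact hs.1)) (hgi t ht), hc]
    field_simp
    ring

theorem tendsto_atTop_of_integral_tendsto_atTop (hat : a ≤ t₀) (hK : 0 < K)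
    (hq : ContinuousOn q (Ici a))
    (hqpos : ∀ t ∈ Ici a, 0 < q t) (hℓ : ∀ t, t₀ ≤ t → HasDerivAt ℓ (g t) t)
    (hlim : Tendsto (fun t => g t / q t) atTop (𝓝 K))
    (hint : Tendsto (fun t => ∫ s in a..t, q s) atTop atTop) : Tendsto ℓ atTop atTop := by
  obtain ⟨B, hB⟩ := eventually_atTop.1 (hlim.eventually_const_lt (half_lt_self hK))
  set D := max (t₀ + 1) B
  have hD : t₀ < D := (lt_add_one t₀).trans_le (le_max_left _ _)
  have hqd : ∀ t, D ≤ t → HasDerivAt (fun t => ∫ s in a..t, q s) (q t) t := fun t ht => by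
    have hat' : a < t := hat.trans_lt (hD.trans_le ht)
    refine intervalIntegral.integral_hasDerivAt_right
      (hq.mono (by rw [uIcc_of_le hat'.le]; exact Icc_subset_Ici_self)).intervalIntegrable ?_
      (hq.continuousAt (Ici_mem_nhds hat'))
    exact hq.stronglyMeasurableAtFilter_nhdsWithin measurableSet_Ici t |>.filter_mono (by
      rw [nhdsWithin_eq_nhds.2 (Ici_mem_nhds hat')])
  -- Eventually `g > (K/2) q`, so `ℓ` dominates half the divergent integral up to a constant.
  have hmono : MonotoneOn (fun t => ℓ t - K / 2 * ∫ s in a..t, q s) (Ici D) := by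
    refine monotoneOn_Ici_of_hasDerivAt
      (fun t ht => (hℓ t (hD.le.trans ht)).sub ((hqd t ht).const_mul (K / 2))) fun t ht => ?_
    have := (lt_div_iff₀ (hqpos t (hat.trans (hD.le.trans ht)))).1
      (hB t ((le_max_right _ _).trans ht))
    linarith
  have h1 := tendsto_atTop_add_const_left atTop (ℓ D - K / 2 * ∫ s in a..D, q s)
    (hint.const_mul_atTop (half_pos hK))
  refine tendsto_atTop_mono' _ ((eventually_ge_atTop D).mono fun t ht => ?_) h1
  have := hmono self_mem_Ici ht ht
  simp only at this
  linarith

/-- The analogue of `exists_eq_integral_one_add` for integrable `q`. -/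
theorem exists_eq_sub_integral_Ioi_one_add (hat : a < t₀) (hK : 0 < K)
    (hqpos : ∀ t ∈ Ici a, 0 < q t) (hℓ : ∀ t, t₀ ≤ t → HasDerivAt ℓ (g t) t)
    (hg : ContinuousOn g (Ici t₀)) (hgpos : ∀ t, t₀ ≤ t → 0 < g t)
    (hlim : Tendsto (fun t => g t / q t) atTop (𝓝 K)) (hint : IntegrableOn q (Ioi a)) :
    ∃ l : ℝ, Tendsto ℓ atTop (𝓝 l) ∧ ∃ ε : ℝ → ℝ, Tendsto ε atTop (𝓝 0) ∧
      IntegrableOn (fun s => (1 + ε s) * K * q s) (Ioi a) ∧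
      ∀ t, t₀ ≤ t → ℓ t = l - ∫ s in Ioi t, (1 + ε s) * K * q s := by
  obtain ⟨B, hB⟩ := eventually_atTop.1 (hlim.eventually_lt_const (lt_add_one K))
  set D := max t₀ B
  have htD : t₀ ≤ D := le_max_left _ _
  have hgi : IntegrableOn g (Ioi t₀) := by
    rw [← Ioc_union_Ioi_eq_Ioi htD]
    refine IntegrableOn.union ?_ ?_
    · exact ((hg.mono Icc_subset_Ici_self).integrableOn_Icc).mono_set Ioc_subset_Icc_self
    · refine Integrable.mono' (g := fun t => (K + 1) * q t)
        ((hint.mono_set (Ioi_subset_Ioi (hat.le.trans htD))).const_mul _)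
        ((hg.mono fun t ht => htD.trans (le_of_lt ht)).aestronglyMeasurable measurableSet_Ioi) ?_
      refine (ae_restrict_iff' measurableSet_Ioi).2 (Eventually.of_forall fun t ht => ?_)
      have htD' : D ≤ t := le_of_lt ht
      rw [Real.norm_of_nonneg (hgpos t (htD.trans htD')).le]
      exact ((div_lt_iff₀ (hqpos t (hat.le.trans (htD.trans htD')))).1
        (hB t ((le_max_right _ _).trans htD'))).le
  have hℓlim : Tendsto ℓ atTop (𝓝 (ℓ t₀ + ∫ s in Ioi t₀, g s)) := by
    refine ((intervalIntegral_tendsto_integral_Ioi t₀ hgi tendsto_id).const_add (ℓ t₀)).congr' ?_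
    filter_upwards [eventually_ge_atTop t₀] with t ht
    have : IntervalIntegrable g volume t₀ t :=
      (hg.mono (by rw [uIcc_of_le ht]; exact Icc_subset_Ici_self)).intervalIntegrable
    simp only [id]
    rw [intervalIntegral.integral_eq_sub_of_hasDerivAt
        (fun s hs => hℓ s (by rw [uIcc_of_le ht] at hs; exact hs.1)) this]
    ring
  -- The value on `(a, t₀]` does not enter the tails from `t ≥ t₀`; it only has to keep the
  -- integrand integrable.
  set ε : ℝ → ℝ := fun t => (if t₀ < t then g t / (K * q t) else 1) - 1 with hε
  have e1 : EqOn (fun s => 1 * K * q s) (fun s => (1 + ε s) * K * q s) (Ioc a t₀) := fun s hs => by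
    simp only [hε]
    rw [one_add_mul_eq_ite hK (hqpos s hs.1.le), if_neg (not_lt.2 hs.2)]
  have e2 : EqOn g (fun s => (1 + ε s) * K * q s) (Ioi t₀) := fun s hs => by
    simp only [hε]
    rw [one_add_mul_eq_ite hK (hqpos s (hat.trans hs).le), if_pos (show t₀ < s from hs)]
  refine ⟨_, hℓlim, ε, tendsto_ite_div_sub_one hK hlim, ?_, fun t ht => ?_⟩
  · rw [← Ioc_union_Ioi_eq_Ioi hat.le]
    refine IntegrableOn.union ?_ (hgi.congr_fun e2 measurableSet_Ioi)
    exact IntegrableOn.congr_fun ((hint.mono_set Ioc_subset_Ioi_self).const_mul (1 * K)) e1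
      measurableSet_Ioc
  · rw [← setIntegral_congr_fun measurableSet_Ioi (e2.mono (Ioi_subset_Ioi ht)),
      integral_Ioi_of_hasDerivAt_of_tendsto (hℓ t ht).continuousAt.continuousWithinAt
        (fun s hs => hℓ s (ht.trans (le_of_lt hs))) (hgi.mono_set (Ioi_subset_Ioi ht)) hℓlim]
    ring

end Primitives

/-! ### Slow variation of the transformed solution and of its distance to the limit. -/

namespace IsTransformedSolution

variable {α A M : ℝ} {P σ x x' v : ℝ → ℝ} (h : IsTransformedSolution α A M P σ x x' v)
include h

theorem isNSV : IsNSV x := by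
  have hψc : ContinuousOn (fun s => s * x' s / x s) (Ici A) :=
    (continuousOn_id.mul h.continuousOn_deriv).div
      (fun s hs => (h.hasDerivAt s hs).continuousAt.continuousWithinAt) fun s hs => (h.pos s hs).ne'
  have hc : ContinuousOn (fun s => x' s / x s) (Ici A) :=
    h.continuousOn_deriv.div (fun s hs => (h.hasDerivAt s hs).continuousAt.continuousWithinAt)
      fun s hs => (h.pos s hs).ne'
  have heq : ∀ t ∈ Ici A, EqOn (fun s => x' s / x s)
      (fun s => (Ici A).indicator (fun s => s * x' s / x s) s / s) (uIoc A t) := fun t ht s hs => by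
    rw [uIoc_of_le ht] at hs
    have : s ≠ 0 := (h.start_pos.trans hs.1).ne'
    simp only
    rw [indicator_of_mem (show s ∈ Ici A from hs.1.le)]
    field_simp
  have hi : ∀ t ∈ Ici A, IntervalIntegrable (fun s => x' s / x s) volume A t := fun t ht =>
    (hc.mono (by rw [uIcc_of_le ht]; exact Icc_subset_Ici_self)).intervalIntegrable
  -- Cutting off below `A` makes `ψ` measurable on the whole line, though `x'` is controlled only on
  -- `[A, ∞)`.
  refine ⟨A, x A, (Ici A).indicator fun s => s * x' s / x s, h.start_pos, h.pos A le_rfl, ?_,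
    ?_, fun t ht => (hi t ht).congr (heq t ht), fun t ht => ?_⟩
  · classical
    rw [← piecewise_eq_indicator]
    exact hψc.measurable_piecewise continuousOn_const measurableSet_Ici
  · refine h.logDeriv_tendsto.congr' ((eventually_ge_atTop A).mono fun s hs => ?_)
    rw [indicator_of_mem (show s ∈ Ici A from hs)]
  · rw [← integral_congr_uIoc (heq t ht),
      intervalIntegral.integral_eq_sub_of_hasDerivAt (f := fun s => Real.log (x s))
        (fun s hs => ?_) (hi t ht), Real.exp_sub, Real.exp_log (h.pos t ht),
      Real.exp_log (h.pos A le_rfl), mul_div_cancel₀ _ (h.pos A le_rfl).ne']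
    rw [uIcc_of_le ht] at hs
    exact (h.hasDerivAt s hs.1).log (h.pos s hs.1).ne'

theorem isSV_abs_sub {N : ℝ} (hN : Tendsto x atTop (𝓝 N)) : IsSV fun s => |x s - N| := by
  obtain ⟨k1, k2, -⟩ := h.sub_limit hN
  refine ⟨⟨A, ?_, fun t ht => abs_pos.2 (sub_neg.2 (k1 t ht)).ne⟩, fun c hc => ?_⟩
  · have : ContinuousOn (fun s => |x s - N|) (Ici A) := ContinuousOn.abs
      (ContinuousOn.sub (fun s hs => (h.hasDerivAt s hs).continuousAt.continuousWithinAt)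
        continuousOn_const)
    exact (continuousOn_iff_continuous_domRestrict.1 this).measurable
  · rw [Real.rpow_zero]
    refine (k2 c hc).congr' ?_
    filter_upwards [eventually_ge_atTop A, eventually_le_const_mul hc A] with s h1 h2
    rw [abs_of_neg (sub_neg.2 (k1 s h1)), abs_of_neg (sub_neg.2 (k1 _ h2)), neg_sub, neg_sub]

end IsTransformedSolution

/-! ### The change of variable `s = Q(t)`. -/

theorem Phi_of_pos {α u : ℝ} (hu : 0 < u) : Phi α u = u ^ (α - 1) := by
  rw [Phi, abs_of_pos hu, Real.sign_of_pos hu, mul_one]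

theorem Phi_neg {α u : ℝ} : Phi α (-u) = -Phi α u := by
  rw [Phi, Phi, abs_neg, Real.sign_neg, mul_neg]

/-- A positive continuous coefficient with `∫_a^∞ r^{1-β} < ∞`. -/
structure IsConvergentWeight (a β : ℝ) (r : ℝ → ℝ) : Prop where
  continuousOn : ContinuousOn r (Ici a)
  pos : ∀ t ∈ Ici a, 0 < r t
  integrableOn : IntegrableOn (fun s => r s ^ (1 - β)) (Ioi a)

namespace IsConvergentWeight

variable {a β : ℝ} {r : ℝ → ℝ} (h : IsConvergentWeight a β r)
include h

theorem continuousOn_rpow (γ : ℝ) : ContinuousOn (fun s => r s ^ γ) (Ici a) :=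
  h.continuousOn.rpow_const fun s hs => Or.inl (h.pos s hs).ne'

theorem rpow_pos (γ : ℝ) {t : ℝ} (ht : a ≤ t) : 0 < r t ^ γ := Real.rpow_pos_of_pos (h.pos t ht) γ

theorem intervalIntegrable {s t : ℝ} (hs : a ≤ s) (hst : s ≤ t) :
    IntervalIntegrable (fun s => r s ^ (1 - β)) volume s t :=
  ((h.continuousOn_rpow _).mono (by
    rw [uIcc_of_le hst]
    exact fun u hu => hs.trans hu.1)).intervalIntegrable

theorem RC_add {s t : ℝ} (hs : a ≤ s) (hst : s ≤ t) :
    (∫ u in s..t, r u ^ (1 - β)) + RC β r t = RC β r s :=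
  intervalIntegral.integral_interval_add_Ioi' (h.intervalIntegrable hs hst)
    (h.integrableOn.mono_set (Ioi_subset_Ioi (hs.trans hst)))

theorem RC_strictAntiOn : StrictAntiOn (RC β r) (Ici a) := fun s hs t ht hst => by
  have h1 := h.RC_add hs hst.le
  have h2 := intervalIntegral.intervalIntegral_pos_of_pos_on (h.intervalIntegrable hs hst.le)
    (fun u hu => h.rpow_pos (1 - β) (le_trans hs hu.1.le)) hst
  linarith

theorem RC_pos {t : ℝ} (ht : a ≤ t) : 0 < RC β r t := by
  have h1 : RC β r (t + 1) < RC β r t :=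
    h.RC_strictAntiOn ht (show a ≤ t + 1 by linarith) (lt_add_one t)
  have h2 : 0 ≤ RC β r (t + 1) := setIntegral_nonneg measurableSet_Ioi fun s hs =>
    (h.rpow_pos _ (by linarith [show t + 1 < s from hs])).le
  linarith

theorem RC_hasDerivAt {t : ℝ} (ht : a < t) : HasDerivAt (RC β r) (-r t ^ (1 - β)) t := by
  have hc := h.continuousOn_rpow (1 - β)
  have h1 : HasDerivAt (fun t => RC β r a - ∫ u in a..t, r u ^ (1 - β)) (-r t ^ (1 - β)) t := by
    refine (intervalIntegral.integral_hasDerivAt_right (h.intervalIntegrable le_rfl ht.le) ?_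
      (hc.continuousAt (Ici_mem_nhds ht))).const_sub _
    exact hc.stronglyMeasurableAtFilter_nhdsWithin measurableSet_Ici t |>.filter_mono (by
      rw [nhdsWithin_eq_nhds.2 (Ici_mem_nhds ht)])
  refine h1.congr_of_eventuallyEq ?_
  filter_upwards [eventually_gt_nhds ht] with s hs
  rw [← h.RC_add le_rfl hs.le]
  ring

theorem RC_tendsto : Tendsto (RC β r) atTop (𝓝 0) := by
  have := (intervalIntegral_tendsto_integral_Ioi a h.integrableOn tendsto_id).const_sub (RC β r a)
  rw [show RC β r a - (∫ x in Ioi a, r x ^ (1 - β)) = 0 from sub_self _] at this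
  refine this.congr' ((eventually_ge_atTop a).mono fun t ht => ?_)
  rw [← h.RC_add le_rfl ht]
  simp only [id]
  ring

theorem Q_pos {t : ℝ} (ht : a ≤ t) : 0 < Q β r t := one_div_pos.2 (h.RC_pos ht)

theorem Q_strictMonoOn : StrictMonoOn (Q β r) (Ici a) := fun _ hs _ ht hst =>
  one_div_lt_one_div_of_lt (h.RC_pos ht) (h.RC_strictAntiOn hs ht hst)

theorem Q_hasDerivAt {t : ℝ} (ht : a < t) :
    HasDerivAt (Q β r) (RC β r t ^ 2 * r t ^ (β - 1))⁻¹ t := by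
  have := (h.RC_hasDerivAt ht).inv (h.RC_pos ht.le).ne'
  have e : Q β r = (RC β r)⁻¹ := by
    ext t
    simp [Q]
  rw [e]
  refine this.congr_deriv ?_
  rw [neg_neg, show 1 - β = -(β - 1) by ring, Real.rpow_neg (h.pos t ht.le).le, div_eq_mul_inv,
    mul_inv, mul_comm]

theorem Q_tendsto : Tendsto (Q β r) atTop atTop := by
  have : Tendsto (RC β r) atTop (𝓝[>] 0) :=
    tendsto_nhdsWithin_iff.2 ⟨h.RC_tendsto, (eventually_ge_atTop a).mono fun t ht => h.RC_pos ht⟩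
  refine (tendsto_inv_nhdsGT_zero.comp this).congr fun t => ?_
  rw [Q, one_div, Function.comp_apply]

theorem Qinv_Q {t : ℝ} (ht : a ≤ t) : Qinv a β r (Q β r t) = t :=
  h.Q_strictMonoOn.injOn.leftInvOn_invFunOn ht

theorem exists_Q_eq {b s : ℝ} (hb : a < b) (hs : Q β r b ≤ s) : ∃ t, b ≤ t ∧ Q β r t = s := by
  obtain ⟨c, hbc, hc⟩ := ((eventually_ge_atTop b).and (h.Q_tendsto.eventually_ge_atTop s)).exists
  have hcont : ContinuousOn (Q β r) (Icc b c) := fun t ht =>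
    (h.Q_hasDerivAt (hb.trans_le ht.1)).continuousAt.continuousWithinAt
  obtain ⟨t, ht, rfl⟩ := intermediate_value_Icc hbc hcont ⟨hs, hc⟩
  exact ⟨t, ht.1, rfl⟩

theorem Q_Qinv {b s : ℝ} (hb : a < b) (hs : Q β r b ≤ s) : Q β r (Qinv a β r s) = s := by
  obtain ⟨t, ht, rfl⟩ := h.exists_Q_eq hb hs
  rw [h.Qinv_Q (hb.le.trans ht)]

theorem le_Qinv {b s : ℝ} (hb : a < b) (hs : Q β r b ≤ s) : b ≤ Qinv a β r s := by
  obtain ⟨t, ht, rfl⟩ := h.exists_Q_eq hb hs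
  rwa [h.Qinv_Q (hb.le.trans ht)]

theorem Qinv_tendsto : Tendsto (Qinv a β r) atTop atTop := by
  refine tendsto_atTop.2 fun b => ?_
  have hb : a < max b (a + 1) := (lt_add_one a).trans_le (le_max_right _ _)
  filter_upwards [eventually_ge_atTop (Q β r (max b (a + 1)))] with s hs
  exact (le_max_left _ _).trans (h.le_Qinv hb hs)

/-- The inverse is strictly monotone with image a neighbourhood of its value, hence continuous, and
the inverse function rule applies. The margin `b > a` is needed because `Q` is differentiated only
at interior points. -/
theorem Qinv_hasDerivAt {b s : ℝ} (hb : a < b) (hs : Q β r b < s) :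
    HasDerivAt (Qinv a β r)
      (RC β r (Qinv a β r s) ^ 2 * r (Qinv a β r s) ^ (β - 1)) s := by
  have hbs := h.le_Qinv hb hs.le
  have hbs' : b < Qinv a β r s := by
    refine lt_of_le_of_ne hbs fun e => ?_
    have := h.Q_Qinv hb hs.le
    rw [← e] at this
    exact hs.ne this
  have hmono : StrictMonoOn (Qinv a β r) (Ici (Q β r b)) := fun u hu w hw huw => by
    have h1 := h.le_Qinv hb hu
    have h2 := h.le_Qinv hb hw
    rw [← h.Q_strictMonoOn.lt_iff_lt (hb.le.trans h1) (hb.le.trans h2), h.Q_Qinv hb hu,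
      h.Q_Qinv hb hw]
    exact huw
  have hcont : ContinuousAt (Qinv a β r) s := by
    refine hmono.continuousAt_of_image_mem_nhds (Ici_mem_nhds hs) ?_
    refine mem_of_superset (Ici_mem_nhds hbs') fun t ht => ?_
    have hbt : b ≤ t := ht
    exact ⟨Q β r t, h.Q_strictMonoOn.monotoneOn hb.le (hb.le.trans hbt) hbt,
      h.Qinv_Q (hb.le.trans hbt)⟩
  have hr0 := h.rpow_pos (β - 1) (hb.le.trans hbs)
  have hR0 := h.RC_pos (hb.le.trans hbs)
  have := HasDerivAt.of_local_left_inverse hcont (h.Q_hasDerivAt (hb.trans hbs'))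
    (by positivity) ((eventually_ge_nhds hs).mono fun u hu => h.Q_Qinv hb hu)
  rwa [inv_inv] at this

/-- The endpoint `a`, not reached by `RC_hasDerivAt`, is included: `q_C` has to be integrable from
`a`. -/
theorem continuousOn_RC : ContinuousOn (RC β r) (Ici a) := by
  have h1 : ContinuousOn (fun t => RC β r a - ∫ u in a..t, r u ^ (1 - β)) (Ici a) := by
    refine continuousOn_const.sub fun t ht => ?_
    have hc := intervalIntegral.continuousOn_primitive_interval
      (μ := volume) (f := fun u => r u ^ (1 - β)) (a := a) (b := t + 1) (by
        have := h.intervalIntegrable le_rfl (show a ≤ t + 1 by linarith [show a ≤ t from ht])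
        rw [uIcc_of_le (by linarith [show a ≤ t from ht])]
        exact ((h.continuousOn_rpow _).mono Icc_subset_Ici_self).integrableOn_Icc)
    rw [uIcc_of_le (by linarith [show a ≤ t from ht])] at hc
    refine (hc t ⟨ht, by linarith⟩).mono_of_mem_nhdsWithin ?_
    rw [← Ici_inter_Iic]
    exact inter_mem self_mem_nhdsWithin (mem_nhdsWithin_of_mem_nhds (Iic_mem_nhds (lt_add_one t)))
  refine h1.congr fun t ht => ?_
  rw [← h.RC_add le_rfl ht]
  ring

theorem qC_pos {p : ℝ → ℝ} {t : ℝ} (ht : a ≤ t) (hp : 0 < p t) : 0 < qC β r p t :=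
  Real.rpow_pos_of_pos (mul_pos (mul_pos (h.RC_pos ht) hp) (h.rpow_pos _ ht)) _

theorem continuousOn_qC {p : ℝ → ℝ} (hp : ContinuousOn p (Ici a)) (hppos : ∀ t ∈ Ici a, 0 < p t) :
    ContinuousOn (qC β r p) (Ici a) :=
  ((h.continuousOn_RC.mul hp).mul (h.continuousOn_rpow _)).rpow_const fun t ht =>
    Or.inl (mul_pos (mul_pos (h.RC_pos ht) (hppos t ht)) (h.rpow_pos _ ht)).ne'

end IsConvergentWeight

/-! ### Transfer of the equation and of its coefficients. -/

/-- The derivative of `y ∘ Q⁻¹`. -/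
noncomputable def derivCompQinv (a β : ℝ) (r y : ℝ → ℝ) (s : ℝ) : ℝ :=
  deriv y (Qinv a β r s) * (RC β r (Qinv a β r s) ^ 2 * r (Qinv a β r s) ^ (β - 1))

theorem conjugate_sub_one_mul {α β : ℝ} (hα : 1 < α) (hαβ : 1 / α + 1 / β = 1) :
    (α - 1) * (β - 1) = 1 := by
  have hα0 : α ≠ 0 := by linarith
  have hβ0 : β ≠ 0 := by
    -- With `1 / 0 = 0` the conjugacy relation would force `α = 1`.
    rintro rfl
    rw [div_zero, add_zero, div_eq_one_iff_eq hα0] at hαβ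
    linarith
  field_simp at hαβ
  linarith

/-- With `s = 1/R` and the chain rule factor `R² ρ^(β-1)`, the old quasiderivative is the new one
with weight `s^(2α-2)`. -/
theorem quasi_eq_of_sub_one_mul {α β R ρ d : ℝ} (hαβ : (α - 1) * (β - 1) = 1) (hR : 0 < R)
    (hρ : 0 < ρ) (hd : 0 < d) :
    ρ * d ^ (α - 1) = (1 / R) ^ (2 * α - 2) * (d * (R ^ 2 * ρ ^ (β - 1))) ^ (α - 1) := by
  have h1 := (Real.rpow_pos_of_pos hρ (β - 1)).le
  rw [Real.mul_rpow hd.le (by positivity), Real.mul_rpow (by positivity) h1,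
    ← Real.rpow_mul hρ.le, mul_comm (β - 1), hαβ, Real.rpow_one, one_div, Real.inv_rpow hR.le,
    ← Real.rpow_natCast R 2, ← Real.rpow_mul hR.le,
    show ((2 : ℕ) : ℝ) * (α - 1) = 2 * α - 2 by push_cast; ring]
  have := (Real.rpow_pos_of_pos hR (2 * α - 2)).ne'
  field_simp

theorem slowPart_eq {α β R ρ π : ℝ} (hR : 0 < R) :
    R ^ 2 * π * ρ ^ (β - 1) / (1 / R) ^ (α - 2) = R ^ α * π * ρ ^ (β - 1) := by
  rw [one_div, Real.inv_rpow hR.le, div_inv_eq_mul, Real.rpow_sub hR, Real.rpow_two]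
  field_simp

/-- Translates `(s x'/x) / L_P^(β-1)` into `(y'/y) / q_C`: the surplus factor `R ρ^(β-1)` is
precisely `s` times the chain rule factor. -/
theorem logDeriv_div_eq {α β R ρ π d u : ℝ} (hαβ : (α - 1) * (β - 1) = 1) (hR : 0 < R)
    (hρ : 0 < ρ) (hπ : 0 < π) :
    1 / R * (d * (R ^ 2 * ρ ^ (β - 1))) / u / (R ^ α * π * ρ ^ (β - 1)) ^ (β - 1) =
      d / u / (R * π * ρ ^ (β - 2)) ^ (β - 1) := by
  have e : (R ^ α * π * ρ ^ (β - 1)) ^ (β - 1) =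
      R * ρ ^ (β - 1) * (R * π * ρ ^ (β - 2)) ^ (β - 1) := by
    have e1 : R ^ α * π * ρ ^ (β - 1) = R ^ (α - 1) * ρ * (R * π * ρ ^ (β - 2)) := by
      rw [Real.rpow_sub_one hR.ne', show β - 1 = β - 2 + 1 by ring, Real.rpow_add_one hρ.ne']
      field_simp
    rw [e1, Real.mul_rpow (by positivity) (by positivity), Real.mul_rpow (by positivity) hρ.le,
      ← Real.rpow_mul hR.le, hαβ, Real.rpow_one]
  rw [e]
  have h1 := (Real.rpow_pos_of_pos hρ (β - 1)).ne'
  have h2 := (Real.rpow_pos_of_pos (show 0 < R * π * ρ ^ (β - 2) by positivity) (β - 1)).ne'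
  field_simp

theorem IsConvergentWeight.exists_isTransformedSolution {a α β : ℝ} {r p τ y : ℝ → ℝ}
    (h : IsConvergentWeight a β r) (hα : 1 < α) (hαβ : (α - 1) * (β - 1) = 1)
    (hppos : ∀ t ∈ Ici a, 0 < p t) (hpC : IsRV (pC a β r p) (α - 2))
    (hLpC : Tendsto (slowPart (pC a β r p) (α - 2)) atTop (𝓝 0))
    (hτle : ∀ t ∈ Ici a, τ t ≤ t) (hτdom : ∀ᶠ t in atTop, a ≤ τ t)
    (hlim : IsBoundedUnder (· ≤ ·) atTop (fun s => s / tauC a β r τ s))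
    (hy : y ∈ classIS a α r p τ) :
    ∃ A M, IsTransformedSolution α A M (pC a β r p) (tauC a β r τ) (fun s => y (Qinv a β r s))
      (derivCompQinv a β r y) (fun s => quasi α r y (Qinv a β r s)) := by
  obtain ⟨⟨T, haT, hsol, hypos⟩, hy'⟩ := hy
  obtain ⟨t₁, ht₁⟩ := eventually_atTop.1 hy'
  set b := max (T + 1) t₁
  have hTb : T < b := (lt_add_one T).trans_le (le_max_left _ _)
  have hab : a < b := haT.trans_lt hTb
  have hd : ∀ t, b ≤ t → HasDerivAt y (deriv y t) t := fun t ht =>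
    ((hsol.contDiffOn.differentiableOn one_ne_zero).differentiableAt
      (Ioi_mem_nhds (hTb.trans_le ht))).hasDerivAt
  have hd' : ∀ t, b ≤ t → 0 < deriv y t := fun t ht => ht₁ t ((le_max_right _ _).trans ht)
  have hpos : ∀ t, b ≤ t → 0 < y t := fun t ht => hypos t (hTb.trans_le ht)
  have hmono : MonotoneOn y (Ici b) := monotoneOn_Ici_of_hasDerivAt hd fun t ht => (hd' t ht).le
  obtain ⟨M₀, hM₀⟩ := hlim
  rw [eventually_map] at hM₀
  -- `M ≥ 1` also turns `σ(s) ≤ s` into `σ(s) ≤ M s`.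
  set M := max M₀ 1
  have hM : 0 < M := one_pos.trans_le (le_max_right _ _)
  have hgrowth : ∀ᶠ t in atTop, Q β r t ≤ M * Q β r (τ t) := by
    filter_upwards [h.Q_tendsto.eventually hM₀, hτdom, eventually_ge_atTop a] with t h1 h2 h3
    rw [tauC, h.Qinv_Q h3, div_le_iff₀ (h.Q_pos h2)] at h1
    exact h1.trans (mul_le_mul_of_nonneg_right (le_max_left _ _) (h.Q_pos h2).le)
  -- `τ` tends to infinity: `τ t < b` would give `Q(t) ≤ M Q(τ t) ≤ M Q(b)`, false for large `t`.
  have hτb : ∀ᶠ t in atTop, b ≤ τ t := by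
    filter_upwards [hgrowth, hτdom, h.Q_tendsto.eventually_gt_atTop (M * Q β r b)] with t h1 h2 h3
    by_contra! h4
    have := h.Q_strictMonoOn h2 hab.le h4
    nlinarith
  obtain ⟨t₂, ht₂⟩ := eventually_atTop.1 hτb
  set c := max b t₂
  have hbc : b ≤ c := le_max_left _ _
  have hac : a < c := hab.trans_le hbc
  -- Starting at `Q(c) + 1` keeps the strict inequality required for differentiating `Q⁻¹` at the
  -- closed left end.
  have hA : ∀ s, Q β r c + 1 ≤ s → Q β r c < s := fun s hs => (lt_add_one _).trans_le hs
  have hc : ∀ s, Q β r c + 1 ≤ s → c ≤ Qinv a β r s := fun s hs => h.le_Qinv hac (hA s hs).le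
  have hbQ : ∀ s, Q β r c + 1 ≤ s → b ≤ Qinv a β r s := fun s hs => hbc.trans (hc s hs)
  have haQ : ∀ s, Q β r c + 1 ≤ s → a ≤ Qinv a β r s := fun s hs => hab.le.trans (hbQ s hs)
  have hQQ : ∀ s, Q β r c + 1 ≤ s → Q β r (Qinv a β r s) = s := fun s hs =>
    h.Q_Qinv hac (hA s hs).le
  have hτQ : ∀ s, Q β r c + 1 ≤ s → b ≤ τ (Qinv a β r s) := fun s hs =>
    ht₂ _ ((le_max_right _ _).trans (hc s hs))
  have hdelay : ∀ s, Q β r c + 1 ≤ s → Qinv a β r (tauC a β r τ s) = τ (Qinv a β r s) :=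
    fun s hs => h.Qinv_Q (hab.le.trans (hτQ s hs))
  have hQd : ∀ s, Q β r c + 1 ≤ s → HasDerivAt (Qinv a β r)
      (RC β r (Qinv a β r s) ^ 2 * r (Qinv a β r s) ^ (β - 1)) s := fun s hs =>
    h.Qinv_hasDerivAt hac (hA s hs)
  have hweight : ∀ t, a ≤ t → 0 < RC β r t ^ 2 * r t ^ (β - 1) := fun t ht =>
    mul_pos (pow_pos (h.RC_pos ht) 2) (h.rpow_pos _ ht)
  have hrhs : ∀ s, Q β r c + 1 ≤ s →
      deriv (quasi α r y) (Qinv a β r s) *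
          (RC β r (Qinv a β r s) ^ 2 * r (Qinv a β r s) ^ (β - 1)) =
        pC a β r p s * y (Qinv a β r (tauC a β r τ s)) ^ (α - 1) := fun s hs => by
    rw [hsol.eqn _ (hTb.trans_le (hbQ s hs)), hdelay s hs, Phi_of_pos (hpos _ (hτQ s hs)), pC]
    ring
  refine ⟨Q β r c + 1, M, hα, by linarith [h.Q_pos hac.le], hM, fun s hs => ?_,
    fun s hs => hpos _ (hbQ s hs), fun s hs => mul_pos (hd' _ (hbQ s hs)) (hweight _ (haQ s hs)),
    fun s hs => ?_, fun s hs => ?_, ?_, fun s hs => ?_, fun s hs => ?_, fun s hs => ?_, ?_, ?_, hLpC,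
    hpC.2⟩
  · exact (hd _ (hbQ s hs)).comp s (hQd s hs)
  · have e := hQQ s hs
    rw [Q] at e
    simp only [quasi, derivCompQinv]
    rw [Phi_of_pos (hd' _ (hbQ s hs))]
    nth_rewrite 3 [← e]
    exact quasi_eq_of_sub_one_mul hαβ (h.RC_pos (haQ s hs)) (h.pos _ (haQ s hs)) (hd' _ (hbQ s hs))
  · rw [← hrhs s hs]
    exact ((hsol.contDiffOn_quasi.differentiableOn one_ne_zero).differentiableAt
      (Ioi_mem_nhds (hTb.trans_le (hbQ s hs)))).hasDerivAt.comp s (hQd s hs)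
  -- The right-hand side is continuous because it is the derivative of a `C¹` quasiderivative times
  -- the chain rule factor.
  · have hQc : ContinuousOn (Qinv a β r) (Ici (Q β r c + 1)) := fun s hs =>
      (hQd s hs).continuousAt.continuousWithinAt
    have hcont : ContinuousOn (fun t => deriv (quasi α r y) t * (RC β r t ^ 2 * r t ^ (β - 1)))
        (Ioi T) :=
      (hsol.contDiffOn_quasi.continuousOn_deriv_of_isOpen isOpen_Ioi le_rfl).mul
        (((h.continuousOn_RC.pow 2).mul (h.continuousOn_rpow _)).mono
          fun t ht => haT.trans (le_of_lt ht))
    exact (hcont.comp hQc fun s hs => hTb.trans_le (hbQ s hs)).congr fun s hs => (hrhs s hs).symm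
  · exact mul_pos (mul_pos (pow_pos (h.RC_pos (haQ s hs)) 2) (hppos _ (haQ s hs)))
      (h.rpow_pos _ (haQ s hs))
  · rw [hdelay s hs]
    exact hpos _ (hτQ s hs)
  · rw [hdelay s hs]
    exact hmono (hτQ s hs) (hbQ s hs) (hτle _ (haQ s hs))
  · filter_upwards [h.Qinv_tendsto.eventually hgrowth, eventually_ge_atTop (Q β r c + 1)] with s h1 h2
    rwa [hQQ s h2] at h1
  · filter_upwards [eventually_ge_atTop (Q β r c + 1)] with s hs
    have h1 : tauC a β r τ s ≤ s := by
      have := h.Q_strictMonoOn.monotoneOn (hab.le.trans (hτQ s hs)) (haQ s hs)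
        (hτle _ (haQ s hs))
      rwa [hQQ s hs] at this
    have h2 : 0 < s := (h.Q_pos hac.le).trans (hA s hs)
    have h3 : 1 ≤ M := le_max_right _ _
    nlinarith

end HalfLinear

/-! ### Conclusion in the original variable. -/

/-- Here `hconv` is convergence of `∫_a^∞ r^{1-β}`; `hτC1`, `hτpos`, `hτle` are the conditions on the
delay `τ`; `hτdom` says that `τ_C = Q ∘ τ ∘ Q⁻¹` is defined near infinity; `hlim`, `hτCsv`,
`hτCbdd` are the conditions on `τ_C`. The two limes superiores being finite is expressed as
boundedness from above near infinity. The function `ε` is the `o(1)` inside the integrals. -/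
theorem theorem3p7
    (a α β : ℝ) (hα : 1 < α) (hαβ : 1 / α + 1 / β = 1)
    (r p τ : ℝ → ℝ)
    (hr : ContinuousOn r (Ici a)) (hrpos : ∀ t ∈ Ici a, 0 < r t)
    (hp : ContinuousOn p (Ici a)) (hppos : ∀ t ∈ Ici a, 0 < p t)
    (hconv : IntegrableOn (fun s => r s ^ (1 - β)) (Ioi a))
    (hpC : HalfLinear.IsRV (HalfLinear.pC a β r p) (α - 2))
    (hLpC : Tendsto (HalfLinear.slowPart (HalfLinear.pC a β r p) (α - 2)) atTop (𝓝 0))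
    (hτC1 : ContDiffOn ℝ 1 τ (Ici a))
    (hτpos : ∀ t ∈ Ici a, 0 < derivWithin τ (Ici a) t)
    (hτle : ∀ t ∈ Ici a, τ t ≤ t)
    (hτdom : ∀ᶠ t in atTop, a ≤ τ t)
    (hlim : IsBoundedUnder (· ≤ ·) atTop (fun s => s / HalfLinear.tauC a β r τ s))
    (hτCsv : HalfLinear.IsSV (deriv (HalfLinear.tauC a β r τ)))
    (hτCbdd : IsBoundedUnder (· ≤ ·) atTop (deriv (HalfLinear.tauC a β r τ))) :
    ∀ y ∈ HalfLinear.classIS a α r p τ,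
      HalfLinear.IsNSV (fun s => y (HalfLinear.Qinv a β r s)) ∧
      (Tendsto (fun t => ∫ s in a..t, HalfLinear.qC β r p s) atTop atTop →
        (∃ ε : ℝ → ℝ, Tendsto ε atTop (𝓝 0) ∧
          (∀ t ∈ Ici a, IntervalIntegrable
            (fun s => (1 + ε s) * (β - 1) ^ (β - 1) * HalfLinear.qC β r p s) volume a t) ∧
          ∀ᶠ t in atTop, y t =
            Real.exp (∫ s in a..t, (1 + ε s) * (β - 1) ^ (β - 1) * HalfLinear.qC β r p s)) ∧
        y ∈ HalfLinear.classISInfInf a α r p τ) ∧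
      (IntegrableOn (HalfLinear.qC β r p) (Ioi a) →
        y ∈ HalfLinear.classISBInf a α r p τ ∧
        ∃ N : ℝ, 0 < N ∧ Tendsto y atTop (𝓝 N) ∧
          (∃ ε : ℝ → ℝ, Tendsto ε atTop (𝓝 0) ∧
            IntegrableOn
              (fun s => (1 + ε s) * (β - 1) ^ (β - 1) * HalfLinear.qC β r p s) (Ioi a) ∧
            ∀ᶠ t in atTop, y t = N * Real.exp
              (-∫ s in Ioi t, (1 + ε s) * (β - 1) ^ (β - 1) * HalfLinear.qC β r p s)) ∧
          HalfLinear.IsSV (fun s => |y (HalfLinear.Qinv a β r s) - N|) ∧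
          Tendsto (fun t => HalfLinear.RC β r t ^ α * p t * r t ^ (β - 1) /
            HalfLinear.Phi α (y t - N)) atTop (𝓝 0)) := by

  intro y hy
  have hw : HalfLinear.IsConvergentWeight a β r := ⟨hr, hrpos, hconv⟩
  have hconj := HalfLinear.conjugate_sub_one_mul hα hαβ
  have hα1 : 0 < α - 1 := by linarith
  have hβ1 : 0 < β - 1 := by
    by_contra! hβ
    nlinarith
  have hinv : (α - 1)⁻¹ = β - 1 := inv_eq_of_mul_eq_one_right hconj
  obtain ⟨A, M, hx⟩ := hw.exists_isTransformedSolution hα hconj hppos hpC hLpC hτle hτdom hlim hy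
  have hK : 0 < (β - 1) ^ (β - 1) := Real.rpow_pos_of_pos hβ1 _
  have hyQ : ∀ t, a ≤ t → y (HalfLinear.Qinv a β r (HalfLinear.Q β r t)) = y t := fun t ht => by
    rw [hw.Qinv_Q ht]
  have hquasi : Tendsto (HalfLinear.quasi α r y) atTop atTop := by
    refine (hx.quasi_tendsto_atTop.comp hw.Q_tendsto).congr' ?_
    filter_upwards [eventually_ge_atTop a] with t ht
    simp only [Function.comp_apply]
    rw [hw.Qinv_Q ht]
  -- The central asymptotic relation; both cases integrate it with `ℓ = log y`.
  have hlog : Tendsto (fun t => deriv y t / y t / HalfLinear.qC β r p t) atTop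
      (𝓝 ((β - 1) ^ (β - 1))) := by
    have := hx.logDeriv_div_tendsto.comp hw.Q_tendsto
    rw [hinv] at this
    refine this.congr' ?_
    filter_upwards [eventually_ge_atTop a] with t ht
    simp only [Function.comp_apply, HalfLinear.derivCompQinv, HalfLinear.pC]
    rw [hw.Qinv_Q ht, HalfLinear.Q, HalfLinear.slowPart_eq (hw.RC_pos ht),
      HalfLinear.logDeriv_div_eq hconj (hw.RC_pos ht) (hrpos t ht) (hppos t ht), HalfLinear.qC]
  obtain ⟨⟨T, haT, hsol, hypos⟩, hy'⟩ := id hy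
  obtain ⟨t₁, ht₁⟩ := eventually_atTop.1 hy'
  set t₀ := max (T + 1) t₁
  have hTt : T < t₀ := (lt_add_one T).trans_le (le_max_left _ _)
  have hat : a < t₀ := haT.trans_lt hTt
  have hpos : ∀ t, t₀ ≤ t → 0 < y t := fun t ht => hypos t (hTt.trans_le ht)
  have hd : ∀ t, t₀ ≤ t → HasDerivAt y (deriv y t) t := fun t ht =>
    ((hsol.contDiffOn.differentiableOn one_ne_zero).differentiableAt
      (Ioi_mem_nhds (hTt.trans_le ht))).hasDerivAt
  have hℓ : ∀ t, t₀ ≤ t → HasDerivAt (fun t => Real.log (y t)) (deriv y t / y t) t :=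
    fun t ht => (hd t ht).log (hpos t ht).ne'
  have hg : ContinuousOn (fun t => deriv y t / y t) (Ici t₀) :=
    ((hsol.contDiffOn.continuousOn_deriv_of_isOpen isOpen_Ioi le_rfl).mono
      fun t ht => hTt.trans_le ht).div
      (fun t ht => (hd t ht).continuousAt.continuousWithinAt) fun t ht => (hpos t ht).ne'
  have hgpos : ∀ t, t₀ ≤ t → 0 < deriv y t / y t := fun t ht =>
    div_pos (ht₁ t ((le_max_right _ _).trans ht)) (hpos t ht)
  have hq := hw.continuousOn_qC hp hppos
  have hqpos : ∀ t ∈ Ici a, 0 < HalfLinear.qC β r p t := fun t ht => hw.qC_pos ht (hppos t ht)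
  refine ⟨hx.isNSV, fun hint => ⟨?_, hy, ?_, hquasi⟩, fun hint => ?_⟩
  · obtain ⟨ε, hε, hεi, hεy⟩ :=
      HalfLinear.exists_eq_integral_one_add hat hK hq hqpos hℓ hg hlog
    refine ⟨ε, hε, hεi, (eventually_ge_atTop t₀).mono fun t ht => ?_⟩
    rw [← hεy t ht, Real.exp_log (hpos t ht)]
  · refine (Real.tendsto_exp_atTop.comp (HalfLinear.tendsto_atTop_of_integral_tendsto_atTop
      hat.le hK hq hqpos hℓ hlog hint)).congr' ((eventually_ge_atTop t₀).mono fun t ht => ?_)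
    exact Real.exp_log (hpos t ht)
  · obtain ⟨l, hl, ε, hε, hεi, hεy⟩ :=
      HalfLinear.exists_eq_sub_integral_Ioi_one_add hat hK hqpos hℓ hg hgpos hlog hint
    have hyl : Tendsto y atTop (𝓝 (Real.exp l)) :=
      ((Real.continuous_exp.tendsto l).comp hl).congr'
        ((eventually_ge_atTop t₀).mono fun t ht => Real.exp_log (hpos t ht))
    have hxl := hyl.comp hw.Qinv_tendsto
    refine ⟨⟨hy, ⟨_, (Real.exp_pos l).ne', hyl⟩, hquasi⟩, Real.exp l, Real.exp_pos l, hyl,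
      ⟨ε, hε, hεi, (eventually_ge_atTop t₀).mono fun t ht => ?_⟩, hx.isSV_abs_sub hxl, ?_⟩
    · rw [← Real.exp_add, ← sub_eq_add_neg, ← hεy t ht, Real.exp_log (hpos t ht)]
    · obtain ⟨k1, -, k3⟩ := hx.sub_limit hxl
      -- `y - N` is negative, so `Φ(y - N) = -(N - y)^(α-1)`.
      have := (k3.comp hw.Q_tendsto).neg
      rw [neg_zero] at this
      refine this.congr' ?_
      filter_upwards [eventually_ge_atTop a, hw.Q_tendsto.eventually_ge_atTop A] with t ht hA
      have hlt := k1 _ hA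
      simp only [hyQ t ht] at hlt
      simp only [Function.comp_apply, HalfLinear.pC]
      rw [hw.Qinv_Q ht, HalfLinear.Q, HalfLinear.slowPart_eq (hw.RC_pos ht),
        ← neg_sub (Real.exp l), HalfLinear.Phi_neg, HalfLinear.Phi_of_pos (sub_pos.2 hlt), div_neg]
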